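/- **Theorem (symmetric energy barrier of the cubic RBH model).** *Lattice.* Let $L_x,L_y\ge 1$, $L_z\ge 2$ be integers. Record a cell of the cubic lattice by the doubled coordinates $(x,y,z)\in\mathbb Z^3$ of its centre, so that its dimension is the number of odd coordinates. The lattice $\mathcal L$ consists of the cells with $0\le x\le 2L_x$, $0\le y\le 2L_y$, $1\le z\le 2L_z-1$, except the vertices and edges with $x=2L_x$; $V,E,F,Q$ denote its vertices, edges, faces and volumes. The facet $x=0$ is the toric code boundary, $x=2L_x$ the sink boundary, $y=0$ and $y=2L_y$ are primal boundaries (giving the two smooth edges of the toric code boundary), and the terminations at $z=0$ and $z=2L_z$ are dual boundaries (giving its two rough edges). There is a qubit on every edge in $E$ and on every face in $F$ with $x>0$. *Hamiltonian.* $$H=-\sum_{i:\,x(i)>0}K_i-\sum_{v\in V,\,x(v)=0}\overline A_v-\sum_{f\in F,\,x(f)=0}\overline B_f ,$$ where $i$ runs over the qubits off the toric code boundary, $K_f=X_f\prod_{e\subset f}Z_e$, $K_e=X_e\prod_{f\supset e}Z_f$, $\overline A_v=\prod_{e\ni v,\,x(e)=0}\bigl(X_e\prod_{f\supset e}Z_f\bigr)$,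 $\overline B_f=\prod_{e\subset f}Z_e$, and all products are over sites that carry a qubit. The 1-form symmetry group is $G=\langle S_v,S_q : v\in V,\ q\in Q\rangle$ with $S_v=\prod_{e\ni v}X_e$ and $S_q=\prod_{f\subset q}X_f$. *Barrier.* A logical operator is a Pauli operator that preserves the ground space of $H$ and does not act on it as a scalar. Fix a range $r\in\mathbb N$. A symmetric local decomposition of a logical operator $\overline l$ is a finite sequence of Pauli operators $l^{(1)}=I,\dots,l^{(N)}=\overline l$, each commuting with $G$, such that $l^{(k+1)}=P_k\,l^{(k)}$ with $P_k$ a Pauli operator supported on qubits whose positions differ pairwise by at most $r$ lattice spacings in every coordinate. Let $E_0$ be the ground energy and $E^{(k)}$ the energy of $l^{(k)}|\psi_0\rangle$ for any ground state $|\psi_0\rangle$. The symmetric energy barrier is $$\Delta_G=\inf_{\overline l}\ \inf_{(l^{(k)})}\ \max_k\,\bigl(E^{(k)}-E_0\bigr).$$ *Width.* $d=\min\{d_Z,d_X,d_{\rm cond}\}$, where $d_Z$ is the lattice distance between the two rough edges of the toric code boundary (the least number of edges of a path joining them), $d_X$ is the distance between its two smooth edges on the dual of the boundary lattice (the least number of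 edges crossed), and $d_{\rm cond}$ is the lattice distance between the toric code boundary and the sink boundary. *Claim.* For every $r$ there is a constant $r'$, depending only on $r$ and not on $L_x,L_y,L_z$, such that for all $L_x,L_y\ge1$, $L_z\ge2$ the energy gap $\Delta_{\rm gap}$ of $H$ (its smallest excitation energy) equals $2$ and $$\Delta_G\ \ge\ d\cdot\frac{\Delta_{\rm gap}}{2}-r' .$$ In particular the barrier grows linearly with the system size: for $L_x=L_y=L_z=n\ge2$ one has $\Delta_G\ge n\,\Delta_{\rm gap}/2-r'$. -/

import Mathlib

noncomputable section

namespace RBH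

/-!
Cells of the cubic lattice are recorded by the doubled coordinates `(x, y, z)` of their centres:
an odd coordinate is a direction in which the cell extends, so the dimension of a cell is the
number of its odd coordinates.
-/

/-- A cell of the ambient cubic lattice, given by the doubled coordinates of its centre. -/
abbrev Cell := ℤ × ℤ × ℤ

/-- The number of directions in which a cell extends. -/
abbrev cellDim (c : Cell) : ℤ := c.1 % 2 + c.2.1 % 2 + c.2.2 % 2

/-- `a ⊂ b`: the cell `a` is contained in (the closure of) the cell `b`. -/
abbrev Inside (a b : Cell) : Prop :=
  (a.1 = b.1 ∨ (Odd b.1 ∧ |a.1 - b.1| = 1)) ∧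
  (a.2.1 = b.2.1 ∨ (Odd b.2.1 ∧ |a.2.1 - b.2.1| = 1)) ∧
  (a.2.2 = b.2.2 ∨ (Odd b.2.2 ∧ |a.2.2 - b.2.2| = 1))

/-- The numbers of 3-cells of the lattice in the three coordinate directions. -/
structure Dims where
  x : ℕ
  y : ℕ
  z : ℕ

/-! ### The lattice

The toric code facet is `x = 0` and the sink facet is `x = 2 * L.x`; the two primal facets are
`y = 0` and `y = 2 * L.y` (lattice terminated smoothly); the two dual facets are at `z = 0` and
`z = 2 * L.z`, where the lattice is terminated such that all the cells lying in these two planes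
are absent, and the edges, faces and volumes that touch them are kept.
On the sink facet there are boundary faces, but no boundary edges and no boundary vertices.
-/

/-- All cell positions of the box, before the termination at the sink facet. -/
def box (L : Dims) : Finset Cell :=
  Finset.Icc (0 : ℤ) (2 * L.x) ×ˢ Finset.Icc (0 : ℤ) (2 * L.y) ×ˢ Finset.Icc (1 : ℤ) (2 * L.z - 1)

/-- The vertices `V`. -/
def vertices (L : Dims) : Finset Cell :=
  (box L).filter fun c => cellDim c = 0 ∧ c.1 < 2 * L.x

/-- The edges `E`. -/
def edges (L : Dims) : Finset Cell :=
  (box L).filter fun c => cellDim c = 1 ∧ c.1 < 2 * L.x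

/-- The faces `F`. -/
def faces (L : Dims) : Finset Cell :=
  (box L).filter fun c => cellDim c = 2

/-- The volumes `Q`. -/
def cubes (L : Dims) : Finset Cell :=
  (box L).filter fun c => cellDim c = 3

/-- The sites that carry a qubit: every edge, and every face that does not lie in the toric code
facet. -/
def qubitSites (L : Dims) : Finset Cell :=
  edges L ∪ (faces L).filter fun c => 0 < c.1

/-- The qubits: dual qubits on edges and primal qubits on faces. -/
abbrev Qubit (L : Dims) := {c : Cell // c ∈ qubitSites L}

/-! ### Pauli operators -/

/-- Computational basis labels. -/
abbrev Config (L : Dims) := Qubit L → ZMod 2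

/-- The state space `⨂ ℂ²`, a state being given by its amplitudes in the computational basis. -/
abbrev QState (L : Dims) := Config L → ℂ

/-- Operators on the state space. -/
abbrev Op (L : Dims) := Module.End ℂ (QState L)

/-- The product of the Pauli operators `X_i` over `i ∈ A`. -/
def opX {L : Dims} (A : Finset (Qubit L)) : Op L where
  toFun ψ := fun s => ψ fun i => if i ∈ A then s i + 1 else s i
  map_add' _ _ := rfl
  map_smul' _ _ := rfl

/-- The product of the Pauli operators `Z_i` over `i ∈ A`. -/
def opZ {L : Dims} (A : Finset (Qubit L)) : Op L where
  toFun ψ := fun s => (∏ i ∈ A, if s i = 0 then (1 : ℂ) else -1) * ψ s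
  map_add' _ _ := by funext s; simp [mul_add]
  map_smul' _ _ := by funext s; simp [mul_left_comm]

/-- `P` is a Pauli operator with support in `A`. -/
def IsPauliOn {L : Dims} (A : Finset (Qubit L)) (P : Op L) : Prop :=
  ∃ (c : ℂ) (B C : Finset (Qubit L)), c ^ 4 = 1 ∧ B ⊆ A ∧ C ⊆ A ∧ P = c • (opX B * opZ C)

/-- `P` is a Pauli operator. -/
def IsPauli {L : Dims} (P : Op L) : Prop := IsPauliOn Finset.univ P

/-- `P` is a Pauli operator of range at most `r` (in units of the lattice spacing): it is
supported on qubits whose positions differ by at most `r` in each of the three coordinates. -/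
def IsLocalPauli {L : Dims} (r : ℕ) (P : Op L) : Prop :=
  ∃ A : Finset (Qubit L), IsPauliOn A P ∧ ∀ i ∈ A, ∀ j ∈ A,
    |i.1.1 - j.1.1| ≤ 2 * r ∧ |i.1.2.1 - j.1.2.1| ≤ 2 * r ∧ |i.1.2.2 - j.1.2.2| ≤ 2 * r

/-! ### The Hamiltonian and the symmetry -/

/-- The neighbours of a qubit: for a face, the edges that it contains; for an edge, the faces
(carrying a qubit) that contain it. -/
def nbrs {L : Dims} (i : Qubit L) : Finset (Qubit L) :=
  Finset.univ.filter fun j => j ≠ i ∧ (Inside j.1 i.1 ∨ Inside i.1 j.1)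

/-- The (possibly truncated) cluster term `K_f` or `K_e`. -/
def clusterTerm {L : Dims} (i : Qubit L) : Op L := opX {i} * opZ (nbrs i)

/-- The edges of the toric code facet that contain `v`. -/
def toricStar {L : Dims} (v : Cell) : Finset (Qubit L) :=
  Finset.univ.filter fun e => cellDim e.1 = 1 ∧ e.1.1 = 0 ∧ Inside v e.1

/-- The dressed star term `A_v = ∏_{e ∋ v} X_e ∏_{f ⊃ e} Z_f`, with `e` in the toric code facet.
Each such `e` lies in exactly one face that carries a qubit, and these faces are distinct for
distinct `e`, so the faces involved are those that contain some edge of the star. -/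
def starTerm (L : Dims) (v : Cell) : Op L :=
  opX (toricStar v) *
    opZ (Finset.univ.filter fun f => cellDim f.1 = 2 ∧ ∃ e ∈ toricStar (L := L) v, Inside e.1 f.1)

/-- The plaquette term `B_f = ∏_{e ⊂ f} Z_e` of a face `f` of the toric code facet. -/
def plaquetteTerm (L : Dims) (f : Cell) : Op L :=
  opZ (Finset.univ.filter fun e => cellDim e.1 = 1 ∧ Inside e.1 f)

/-- The Hamiltonian of the cubic RBH model: the cluster terms of the bulk and of the primal, dual
and sink facets (all qubits off the toric code facet), and the dressed toric code. -/
def hamiltonian (L : Dims) : Op L :=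
  -(∑ i ∈ Finset.univ.filter (fun i : Qubit L => 0 < i.1.1), clusterTerm i)
    - ∑ v ∈ (vertices L).filter (fun v => v.1 = 0), starTerm L v
    - ∑ f ∈ (faces L).filter (fun f => f.1 = 0), plaquetteTerm L f

/-- The 1-form symmetry generator `S_v = ∏_{e ∋ v} X_e`. -/
def symV (L : Dims) (v : Cell) : Op L :=
  opX (Finset.univ.filter fun e => cellDim e.1 = 1 ∧ Inside v e.1)

/-- The 1-form symmetry generator `S_q = ∏_{f ⊂ q} X_f`. -/
def symQ (L : Dims) (q : Cell) : Op L :=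
  opX (Finset.univ.filter fun f => cellDim f.1 = 2 ∧ Inside f.1 q)

/-- The 1-form symmetry group `G = ⟨S_v, S_q⟩`. The generators are involutions, so the monoid that
they generate is a group. -/
def symGroup (L : Dims) : Submonoid (Op L) :=
  Submonoid.closure (symV L '' (vertices L : Set Cell) ∪ symQ L '' (cubes L : Set Cell))

/-! ### Energies and the symmetric energy barrier -/

/-- The smallest eigenvalue `E₀`. -/
def groundEnergy {L : Dims} (H : Op L) : ℝ :=
  sInf {E : ℝ | H.HasEigenvalue (E : ℂ)}

/-- The ground space. -/
def groundSpace {L : Dims} (H : Op L) : Submodule ℂ (QState L) :=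
  H.eigenspace (groundEnergy H : ℂ)

/-- The energy gap: the smallest excitation energy. -/
def energyGap {L : Dims} (H : Op L) : ℝ :=
  sInf {E : ℝ | H.HasEigenvalue (E : ℂ) ∧ groundEnergy H < E} - groundEnergy H

/-- `P` maps every ground state of `H` to an eigenstate of energy `E`. -/
def HasEnergy {L : Dims} (H P : Op L) (E : ℝ) : Prop :=
  ∀ ψ ∈ groundSpace H, ψ ≠ 0 → H.HasEigenvector (E : ℂ) (P ψ)

/-- A (nontrivial) Pauli logical operator: it preserves the ground space and does not act on it as
a scalar. -/
def IsLogical {L : Dims} (H P : Op L) : Prop :=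
  IsPauli P ∧ (∀ ψ ∈ groundSpace H, P ψ ∈ groundSpace H) ∧
    ¬ ∃ c : ℂ, ∀ ψ ∈ groundSpace H, P ψ = c • ψ

/-- `p 0, …, p N` is a local decomposition of `l`, with steps of range at most `r`, that is
symmetric under `G`. -/
structure IsSymLocalDecomp {L : Dims} (G : Submonoid (Op L)) (r : ℕ) (l : Op L) {N : ℕ}
    (p : Fin (N + 1) → Op L) : Prop where
  pauli : ∀ k, IsPauli (p k)
  first : p 0 = 1
  last : p (Fin.last N) = l
  step : ∀ k : Fin N, ∃ P : Op L, IsLocalPauli r P ∧ p k.succ = P * p k.castSucc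
  symmetric : ∀ k, ∀ g ∈ G, Commute (p k) g

/-- The energy barrier `max_k (E^(k) - E₀)` of a sequence of operators, where `E^(k)` is the energy
of `p k ψ₀` for any ground state `ψ₀`. -/
def decompBarrier {L : Dims} (H : Op L) {N : ℕ} (p : Fin (N + 1) → Op L) : EReal :=
  ⨆ (k : Fin (N + 1)) (E : ℝ) (_ : HasEnergy H (p k) E), ((E - groundEnergy H : ℝ) : EReal)

/-- The symmetric energy barrier for a logical fault: the smallest barrier of any symmetric local
decomposition (with steps of range at most `r`) of any logical operator. -/
def symEnergyBarrier {L : Dims} (H : Op L) (G : Submonoid (Op L)) (r : ℕ) : EReal :=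
  ⨅ (l : Op L) (_ : IsLogical H l) (N : ℕ) (p : Fin (N + 1) → Op L)
    (_ : IsSymLocalDecomp G r l p), decompBarrier H p

/-! ### The lattice width -/

/-- The smallest length of a walk from `A` to `B`. -/
def walkDist (Γ : SimpleGraph Cell) (A B : Set Cell) : ℕ :=
  sInf {n | ∃ u ∈ A, ∃ v ∈ B, ∃ w : Γ.Walk u v, w.length = n}

/-- The graph formed by the edges of the lattice, including the end points of the edges that
stick out at the dual and sink facets. -/
def latticeGraph (L : Dims) : SimpleGraph Cell :=
  SimpleGraph.fromRel fun u v =>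
    cellDim u = 0 ∧ cellDim v = 0 ∧ ∃ e ∈ edges L, Inside u e ∧ Inside v e

/-- The dual of the lattice of the toric code facet: two faces in the plane `x = 0` are joined when
they share an edge of the toric code facet; dual edges stick out at the two smooth edges. -/
def toricDualGraph (L : Dims) : SimpleGraph Cell :=
  SimpleGraph.fromRel fun f g =>
    (cellDim f = 2 ∧ f.1 = 0) ∧ (cellDim g = 2 ∧ g.1 = 0) ∧
      ∃ e ∈ edges L, e.1 = 0 ∧ Inside e f ∧ Inside e g

/-- The distance `d_Z` between the two rough edges of the toric code facet. -/
def dZ (L : Dims) : ℕ :=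
  walkDist (latticeGraph L) {v | cellDim v = 0 ∧ v.1 = 0 ∧ v.2.2 = 0}
    {v | cellDim v = 0 ∧ v.1 = 0 ∧ v.2.2 = 2 * L.z}

/-- The distance `d_X` between the two smooth edges of the toric code facet, on the dual lattice;
it counts the edges crossed. -/
def dX (L : Dims) : ℕ :=
  walkDist (toricDualGraph L) {f | cellDim f = 2 ∧ f.1 = 0 ∧ f.2.1 = -1}
    {f | cellDim f = 2 ∧ f.1 = 0 ∧ f.2.1 = 2 * L.y + 1}

/-- The distance `d_cond` between the toric code facet and the sink facet. -/
def dCond (L : Dims) : ℕ :=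
  walkDist (latticeGraph L) {v | cellDim v = 0 ∧ v.1 = 0} {v | cellDim v = 0 ∧ v.1 = 2 * L.x}

/-- The lattice width `d = min {d_Z, d_X, d_cond}`. -/
def latticeWidth (L : Dims) : ℕ := min (dZ L) (min (dX L) (dCond L))

end RBH

end

noncomputable section

namespace RBH

open Finset

/-! ### Pauli operators as binary vectors -/

/-! Up to a phase a Pauli operator is a pair of binary vectors, and commutation is the bilinear form
`comm`. The terms of the Hamiltonian are commuting involutions with a common fixed vector
(`exists_ground_state`), so a Pauli operator raises the ground energy by exactly 2 per term that it
anticommutes with (`hasEnergy_pauli`). This reduces the barrier to counting violated terms, and the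
gap to exhibiting an operator that violates exactly one.

The count rests on a conservation law. The `syndrome` records commutation with the cluster operator
of every cell, including those of the toric facet that are not in the Hamiltonian. For an operator
commuting with the 1-form symmetry, the syndrome on edges has no end points at vertices, and the
syndrome on faces has none in volumes (`nnSum_syndrome_vertex`, `nnSum_syndrome_cube`). With fewer
than `L.x` violated cluster terms, some layer parallel to the facet is free of them, so no flux
escapes to the sink. Hence the flux through the planes transverse to a direction is constant, and at
a plane without violations it comes from the toric facet alone (`crossingZ_eq`, `crossingY_eq`).

A local step misses most planes. While violations are few, some free plane is out of its reach, the
crossing parity there is unchanged, and by constancy all crossing parities stay even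
(`IsEvenVec.add_local`). But an operator with no violation and even crossings is a product of
Hamiltonian terms up to phase, so it is a scalar on the ground space (`actsScalar_of_even`). A
decomposition of a logical operator must therefore pass through many violations
(`exists_many_violations`). -/

/-- The sign `(-1) ^ x`. -/
def sgn (x : ZMod 2) : ℂ := if x = 0 then 1 else -1

@[simp] lemma sgn_zero : sgn 0 = 1 := by simp [sgn]

@[simp] lemma sgn_one : sgn 1 = -1 := by simp [sgn]

lemma zmod_two_cases (x : ZMod 2) : x = 0 ∨ x = 1 := by revert x; decide

lemma sgn_add (x y : ZMod 2) : sgn (x + y) = sgn x * sgn y := by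
  rcases zmod_two_cases x with rfl | rfl <;> rcases zmod_two_cases y with rfl | rfl <;>
    simp [show (1 : ZMod 2) + 1 = 0 from rfl]

lemma sgn_sum {ι : Type*} (s : Finset ι) (f : ι → ZMod 2) :
    sgn (∑ i ∈ s, f i) = ∏ i ∈ s, sgn (f i) := by
  classical
  induction s using Finset.induction_on with
  | empty => simp
  | insert i s hi ih => rw [sum_insert hi, prod_insert hi, sgn_add, ih]

lemma sgn_mul_self (x : ZMod 2) : sgn x * sgn x = 1 := by
  rw [← sgn_add, CharTwo.add_self_eq_zero, sgn_zero]

lemma sgn_ne_zero (x : ZMod 2) : sgn x ≠ 0 := fun h => by simpa [h] using sgn_mul_self x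

lemma sgn_eq_one_iff {x : ZMod 2} : sgn x = 1 ↔ x = 0 := by
  rcases zmod_two_cases x with rfl | rfl
  · simp
  · norm_num

variable {L : Dims}

/-- The indicator function of a set of qubits. -/
def ind (S : Finset (Qubit L)) : Config L := fun i => if i ∈ S then 1 else 0

/-- A Pauli operator up to a phase: its `X` part and its `Z` part. -/
abbrev PauliVec (L : Dims) := Config L × Config L

/-- The Pauli operator `X^p.1 Z^p.2`. -/
def pauli (p : PauliVec L) : Op L where
  toFun ψ := fun s => sgn (p.2 ⬝ᵥ (s + p.1)) * ψ (s + p.1)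
  map_add' _ _ := by funext s; simp [mul_add]
  map_smul' _ _ := by funext s; simp [mul_left_comm]

lemma pauli_apply (p : PauliVec L) (ψ : QState L) (s : Config L) :
    pauli p ψ s = sgn (p.2 ⬝ᵥ (s + p.1)) * ψ (s + p.1) := rfl

/-- The commutation form of two Pauli operators. -/
def comm (p q : PauliVec L) : ZMod 2 := p.2 ⬝ᵥ q.1 + q.2 ⬝ᵥ p.1

lemma comm_symm (p q : PauliVec L) : comm p q = comm q p := add_comm _ _

lemma comm_add_left (p p' q : PauliVec L) : comm (p + p') q = comm p q + comm p' q := by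
  simp only [comm, Prod.fst_add, Prod.snd_add, add_dotProduct, dotProduct_add]; ring

lemma comm_zero_left (q : PauliVec L) : comm 0 q = 0 := by
  simp [comm]

/-- The sign comes from moving the `Z` part of `p` past the `X` part of `q`. -/
lemma pauli_mul (p q : PauliVec L) :
    pauli p * pauli q = sgn (p.2 ⬝ᵥ q.1) • pauli (p + q) := by
  refine LinearMap.ext fun ψ => funext fun s => ?_
  simp only [Module.End.mul_apply, LinearMap.smul_apply, Pi.smul_apply, smul_eq_mul, pauli_apply,
    Prod.fst_add, Prod.snd_add, ← mul_assoc, ← sgn_add, add_assoc]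
  congr 2
  simp only [add_dotProduct, dotProduct_add]
  linear_combination (-CharTwo.add_self_eq_zero (p.2 ⬝ᵥ q.1))

lemma pauli_zero : pauli (0 : PauliVec L) = 1 := by
  refine LinearMap.ext fun ψ => funext fun s => ?_
  simp [pauli_apply]

lemma pauli_mul_comm (p q : PauliVec L) :
    pauli p * pauli q = sgn (comm p q) • (pauli q * pauli p) := by
  rw [pauli_mul, pauli_mul, smul_smul, add_comm q p, comm, sgn_add, mul_assoc, sgn_mul_self,
    mul_one]

lemma pauli_mul_self (p : PauliVec L) : pauli p * pauli p = sgn (p.2 ⬝ᵥ p.1) • 1 := by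
  rw [pauli_mul, show p + p = 0 from by
    ext i <;> exact CharTwo.add_self_eq_zero _, pauli_zero]

lemma pauli_injective (p : PauliVec L) : Function.Injective (pauli p) := by
  intro ψ φ h
  have h2 := congrArg (pauli p) h
  simp only [← Module.End.mul_apply, pauli_mul_self, LinearMap.smul_apply,
    Module.End.one_apply] at h2
  exact smul_right_injective _ (sgn_ne_zero _) h2

lemma dotProduct_ind (a : Config L) (S : Finset (Qubit L)) : a ⬝ᵥ ind S = ∑ i ∈ S, a i := by
  simp only [dotProduct, ind, mul_ite, mul_one, mul_zero, sum_ite_mem, univ_inter]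

lemma ind_dotProduct (a : Config L) (S : Finset (Qubit L)) : ind S ⬝ᵥ a = ∑ i ∈ S, a i := by
  rw [dotProduct_comm, dotProduct_ind]

lemma opX_mul_opZ (B C : Finset (Qubit L)) : opX B * opZ C = pauli (ind B, ind C) := by
  refine LinearMap.ext fun ψ => funext fun s => ?_
  have hs : (fun i => if i ∈ B then s i + 1 else s i) = s + ind B := by
    funext i; by_cases h : i ∈ B <;> simp [ind, h]
  simp only [Module.End.mul_apply, opX, opZ, LinearMap.coe_mk, AddHom.coe_mk, pauli_apply, hs,
    ind_dotProduct, sgn_sum]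
  rw [← hs]
  rfl

@[simp] lemma ind_empty : ind (∅ : Finset (Qubit L)) = 0 := by
  funext i; simp [ind]

lemma opX_empty : opX (∅ : Finset (Qubit L)) = 1 := by
  refine LinearMap.ext fun ψ => funext fun s => ?_; simp [opX]

lemma opZ_empty : opZ (∅ : Finset (Qubit L)) = 1 := by
  refine LinearMap.ext fun ψ => funext fun s => ?_; simp [opZ]

lemma opX_eq_pauli (B : Finset (Qubit L)) : opX B = pauli (ind B, 0) := by
  rw [← ind_empty, ← opX_mul_opZ, opZ_empty, mul_one]

lemma opZ_eq_pauli (C : Finset (Qubit L)) : opZ C = pauli (0, ind C) := by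
  rw [← ind_empty, ← opX_mul_opZ, opX_empty, one_mul]

lemma IsPauliOn.exists_vec {A : Finset (Qubit L)} {P : Op L} (h : IsPauliOn A P) :
    ∃ (c : ℂ) (p : PauliVec L), c ≠ 0 ∧ P = c • pauli p ∧
      ∀ i, i ∉ A → p.1 i = 0 ∧ p.2 i = 0 := by
  obtain ⟨c, B, C, hc, hB, hC, rfl⟩ := h
  refine ⟨c, (ind B, ind C), ?_, by rw [opX_mul_opZ], fun i hi => ⟨?_, ?_⟩⟩
  · rintro rfl; norm_num at hc
  · exact if_neg fun h => hi (hB h)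
  · exact if_neg fun h => hi (hC h)

lemma comm_eq_zero_of_commute {c : ℂ} (hc : c ≠ 0) {p q : PauliVec L}
    (h : Commute (c • pauli p) (pauli q)) : comm p q = 0 := by
  have h1 : c • (pauli p * pauli q) = c • (pauli q * pauli p) := by
    simpa [Commute, SemiconjBy, smul_mul_assoc, mul_smul_comm] using h
  have h2 := smul_right_injective _ hc h1
  rw [pauli_mul_comm] at h2
  -- Any nonzero state would do as a test vector: Pauli operators are injective, so its image is
  -- nonzero and the sign must be 1.
  have h3 := LinearMap.congr_fun h2 (fun _ => 1)
  have h4 : (pauli q * pauli p) (fun _ => 1) ≠ (0 : QState L) := by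
    intro h0
    rw [Module.End.mul_apply] at h0
    have h5 := pauli_injective p (pauli_injective q (h0.trans (map_zero _).symm) |>.trans
      (map_zero _).symm)
    simpa using congrFun h5 0
  rw [LinearMap.smul_apply] at h3
  have h5 : (sgn (comm p q) - 1) • (pauli q * pauli p) (fun _ => 1) = (0 : QState L) := by
    rw [sub_smul, h3, one_smul, sub_self]
  exact sgn_eq_one_iff.1 (sub_eq_zero.1 ((smul_eq_zero.1 h5).resolve_right h4))

/-! ### Spectra of sums of commuting involutions -/

/-- Commuting involutions have a joint eigenvector in any nonzero invariant subspace. -/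
lemma exists_joint_eigenvector {V J : Type*} [AddCommGroup V] [Module ℂ V]
    (T : J → Module.End ℂ V) (hT : ∀ i j, T i * T j = T j * T i) (hT2 : ∀ i, T i * T i = 1)
    (S : Submodule ℂ V) (hS : ∀ i, ∀ ψ ∈ S, T i ψ ∈ S) {φ : V} (hφ : φ ∈ S) (h0 : φ ≠ 0)
    (s : Finset J) :
    ∃ φ' ∈ S, φ' ≠ 0 ∧ ∃ σ : J → ZMod 2, ∀ j ∈ s, T j φ' = sgn (σ j) • φ' := by
  classical
  induction s using Finset.induction_on with
  | empty => exact ⟨φ, hφ, h0, 0, by simp⟩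
  | insert i s hi ih =>
    obtain ⟨φ', hφ', h0', σ, hσ⟩ := ih
    -- Up to a factor these are the projections of `φ'` to the two eigenspaces of `T i`. They add up
    -- to `2 • φ'`, so at least one is nonzero.
    have key (ε : ZMod 2) (hne : φ' + sgn ε • T i φ' ≠ 0) :
        ∃ φ' ∈ S, φ' ≠ 0 ∧ ∃ σ : J → ZMod 2, ∀ j ∈ insert i s, T j φ' = sgn (σ j) • φ' := by
      refine ⟨_, S.add_mem hφ' (S.smul_mem (sgn ε) (hS i _ hφ')), hne, Function.update σ i ε,
        fun j hj => ?_⟩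
      by_cases hji : j = i
      · subst hji
        rw [Function.update_self, map_add, map_smul, ← Module.End.mul_apply, hT2,
          Module.End.one_apply, smul_add, smul_smul, sgn_mul_self, one_smul, add_comm]
      · rw [Function.update_of_ne hji, map_add, map_smul, ← Module.End.mul_apply, hT j i,
          Module.End.mul_apply, hσ j ((mem_insert.1 hj).resolve_left hji), map_smul, smul_add,
          smul_comm]
    by_cases hne : φ' + sgn 0 • T i φ' = 0
    · refine key 1 fun hne' => h0' ?_
      have : (2 : ℂ) • φ' = 0 := by
        rw [two_smul]
        calc φ' + φ' = (φ' + sgn 0 • T i φ') + (φ' + sgn 1 • T i φ') := by simp; abel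
          _ = 0 := by rw [hne, hne', add_zero]
      exact (smul_eq_zero.1 this).resolve_left two_ne_zero
    · exact key 0 hne

/-- The number of minus signs of a sign pattern. -/
def minusCount {J : Type*} [Fintype J] (σ : J → ZMod 2) : ℕ := (univ.filter fun j => σ j ≠ 0).card

lemma neg_sum_sgn {J : Type*} [Fintype J] (σ : J → ZMod 2) :
    -∑ j, sgn (σ j) = ((-(Fintype.card J : ℝ) + 2 * minusCount σ : ℝ) : ℂ) := by
  have h : ∀ j, sgn (σ j) = 1 - 2 * (if σ j ≠ 0 then 1 else 0) := fun j => by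
    rcases zmod_two_cases (σ j) with h | h <;> simp [h]; norm_num
  simp only [h, sum_sub_distrib, ← mul_sum, sum_boole]
  simp only [sum_const, card_univ, nsmul_eq_mul, mul_one, minusCount]
  push_cast
  ring

lemma neg_sum_apply {V J : Type*} [AddCommGroup V] [Module ℂ V] [Fintype J]
    {T : J → Module.End ℂ V} {σ : J → ZMod 2} {φ : V} (h : ∀ j, T j φ = sgn (σ j) • φ) :
    (-∑ j, T j) φ = ((-(Fintype.card J : ℝ) + 2 * minusCount σ : ℝ) : ℂ) • φ := by
  rw [← neg_sum_sgn, LinearMap.neg_apply, LinearMap.sum_apply, neg_smul, sum_smul]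
  simp [h]

lemma mul_neg_sum_comm {R J : Type*} [Ring R] [Fintype J] {T : J → R}
    (hT : ∀ i j, T i * T j = T j * T i) (i : J) : T i * (-∑ j, T j) = (-∑ j, T j) * T i := by
  simp only [mul_neg, neg_mul, mul_sum, sum_mul, hT i]

/-- A joint eigenvector of the terms inside an eigenspace of minus their sum. -/
lemma exists_sign_pattern {V J : Type*} [AddCommGroup V] [Module ℂ V] [Fintype J]
    (T : J → Module.End ℂ V) (hT : ∀ i j, T i * T j = T j * T i) (hT2 : ∀ i, T i * T i = 1)
    (S : Submodule ℂ V) (hS : ∀ i, ∀ ψ ∈ S, T i ψ ∈ S) {φ : V} (hφ : φ ∈ S) (h0 : φ ≠ 0) {E : ℝ}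
    (hE : (-∑ j, T j) φ = (E : ℂ) • φ) :
    ∃ φ' ∈ S, φ' ≠ 0 ∧ ∃ σ : J → ZMod 2, (∀ j, T j φ' = sgn (σ j) • φ') ∧
      E = -(Fintype.card J : ℝ) + 2 * minusCount σ := by
  obtain ⟨φ', ⟨h1, h2⟩, h3, σ, hσ⟩ := exists_joint_eigenvector T hT hT2
    (S ⊓ (-∑ j, T j).eigenspace (E : ℂ)) (fun i ψ hψ => ⟨hS i ψ hψ.1, by
      have := Module.End.mem_eigenspace_iff.1 hψ.2
      rw [SetLike.mem_coe, Module.End.mem_eigenspace_iff, ← Module.End.mul_apply,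
        ← mul_neg_sum_comm hT, Module.End.mul_apply, this, map_smul]⟩)
    ⟨hφ, Module.End.mem_eigenspace_iff.2 hE⟩ h0 univ
  have h4 := Module.End.mem_eigenspace_iff.1 h2
  rw [neg_sum_apply fun j => hσ j (mem_univ j)] at h4
  refine ⟨φ', h1, h3, σ, fun j => hσ j (mem_univ j), ?_⟩
  exact_mod_cast (smul_left_injective ℂ h3 h4).symm

/-- The lowest eigenspace of minus a sum of commuting involutions. -/
lemma neg_sum_apply_eq_iff {V J : Type*} [AddCommGroup V] [Module ℂ V] [Fintype J]
    {T : J → Module.End ℂ V} (hT : ∀ i j, T i * T j = T j * T i) (hT2 : ∀ i, T i * T i = 1)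
    {ψ : V} :
    (-∑ j, T j) ψ = ((-(Fintype.card J : ℝ) : ℝ) : ℂ) • ψ ↔ ∀ t, T t ψ = ψ := by
  constructor
  · intro h t
    by_contra hne
    -- A nonzero `φ` is a `-1` eigenvector of `T t` in the same eigenspace of the sum. A joint
    -- eigenvector found there would have no minus sign at all, contradicting the one at `t`.
    set φ := ψ - T t ψ with hφ
    have h0 : φ ≠ 0 := fun h => hne (sub_eq_zero.1 h).symm
    have h1 : φ ∈ (T t).eigenspace (-1) := by
      rw [Module.End.mem_eigenspace_iff, hφ, map_sub, ← Module.End.mul_apply, hT2,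
        Module.End.one_apply, neg_one_smul, neg_sub]
    have h2 : (-∑ s, T s) φ = ((-(Fintype.card J : ℝ) : ℝ) : ℂ) • φ := by
      rw [hφ, map_sub, ← Module.End.mul_apply, ← mul_neg_sum_comm hT, Module.End.mul_apply, h,
        map_smul, smul_sub]
    obtain ⟨φ', h3, h4, σ, h5, h6⟩ := exists_sign_pattern T hT hT2 _ (fun s ψ hψ => by
        rw [Module.End.mem_eigenspace_iff] at hψ ⊢
        rw [← Module.End.mul_apply, hT, Module.End.mul_apply, hψ, map_smul]) h1 h0 h2
    have h7 : minusCount σ = 0 := by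
      have : (minusCount σ : ℝ) = 0 := by linarith
      exact_mod_cast this
    have h8 : σ t = 0 := by
      by_contra h
      exact filter_eq_empty_iff.1 (card_eq_zero.1 h7) (mem_univ t) h
    have h9 := h5 t
    rw [h8, sgn_zero, Module.End.mem_eigenspace_iff.1 h3] at h9
    have := smul_left_injective ℂ h4 h9
    norm_num at this
  · intro h
    have h1 : minusCount (0 : J → ZMod 2) = 0 :=
      card_eq_zero.2 (filter_eq_empty_iff.2 fun _ _ h => h rfl)
    have := neg_sum_apply (T := T) (σ := 0) (φ := ψ)
      fun t => by rw [h t, Pi.zero_apply, sgn_zero, one_smul]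
    rwa [h1, Nat.cast_zero, mul_zero, add_zero] at this

/-! ### Functions on the cells of the ambient lattice -/

lemma mem_box {x y z : ℤ} : (x, y, z) ∈ box L ↔
    (0 ≤ x ∧ x ≤ 2 * L.x) ∧ (0 ≤ y ∧ y ≤ 2 * L.y) ∧ 1 ≤ z ∧ z ≤ 2 * L.z - 1 := by
  simp only [box, mem_product, mem_Icc]

lemma mem_qubitSites {x y z : ℤ} : (x, y, z) ∈ qubitSites L ↔
    ((0 ≤ x ∧ x ≤ 2 * L.x) ∧ (0 ≤ y ∧ y ≤ 2 * L.y) ∧ 1 ≤ z ∧ z ≤ 2 * L.z - 1) ∧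
      (x % 2 + y % 2 + z % 2 = 1 ∧ x < 2 * L.x ∨ x % 2 + y % 2 + z % 2 = 2 ∧ 0 < x) := by
  simp only [qubitSites, edges, faces, mem_union, mem_filter, mem_box]
  tauto

lemma mem_vertices {x y z : ℤ} : (x, y, z) ∈ vertices L ↔
    ((0 ≤ x ∧ x ≤ 2 * L.x) ∧ (0 ≤ y ∧ y ≤ 2 * L.y) ∧ 1 ≤ z ∧ z ≤ 2 * L.z - 1) ∧
      x % 2 + y % 2 + z % 2 = 0 ∧ x < 2 * L.x := by
  simp only [vertices, mem_filter, mem_box]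

lemma mem_edges {x y z : ℤ} : (x, y, z) ∈ edges L ↔
    ((0 ≤ x ∧ x ≤ 2 * L.x) ∧ (0 ≤ y ∧ y ≤ 2 * L.y) ∧ 1 ≤ z ∧ z ≤ 2 * L.z - 1) ∧
      x % 2 + y % 2 + z % 2 = 1 ∧ x < 2 * L.x := by
  simp only [edges, mem_filter, mem_box]

lemma mem_faces {x y z : ℤ} : (x, y, z) ∈ faces L ↔
    ((0 ≤ x ∧ x ≤ 2 * L.x) ∧ (0 ≤ y ∧ y ≤ 2 * L.y) ∧ 1 ≤ z ∧ z ≤ 2 * L.z - 1) ∧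
      x % 2 + y % 2 + z % 2 = 2 := by
  simp only [faces, mem_filter, mem_box]

lemma mem_cubes {x y z : ℤ} : (x, y, z) ∈ cubes L ↔
    ((0 ≤ x ∧ x ≤ 2 * L.x) ∧ (0 ≤ y ∧ y ≤ 2 * L.y) ∧ 1 ≤ z ∧ z ≤ 2 * L.z - 1) ∧
      x % 2 + y % 2 + z % 2 = 3 := by
  simp only [cubes, mem_filter, mem_box]

lemma inside_iff {x y z x' y' z' : ℤ} : Inside (x, y, z) (x', y', z') ↔
    (x = x' ∨ x' % 2 = 1 ∧ (x = x' + 1 ∨ x = x' - 1)) ∧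
    (y = y' ∨ y' % 2 = 1 ∧ (y = y' + 1 ∨ y = y' - 1)) ∧
    (z = z' ∨ z' % 2 = 1 ∧ (z = z' + 1 ∨ z = z' - 1)) := by
  have h (a b : ℤ) : (a = b ∨ (Odd b ∧ |a - b| = 1)) ↔
      (a = b ∨ b % 2 = 1 ∧ (a = b + 1 ∨ a = b - 1)) := by
    rw [Int.odd_iff, abs_eq one_pos.le]; omega
  simp only [Inside, h]

/-- The extension by zero of a function on the qubits to all cells. -/
def cellExt (a : Config L) (x y z : ℤ) : ZMod 2 :=
  if h : (x, y, z) ∈ qubitSites L then a ⟨(x, y, z), h⟩ else 0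

lemma cellExt_of_mem (a : Config L) {x y z : ℤ} (h : (x, y, z) ∈ qubitSites L) :
    cellExt a x y z = a ⟨(x, y, z), h⟩ := dif_pos h

lemma cellExt_eq_zero (a : Config L) {x y z : ℤ} (h : (x, y, z) ∉ qubitSites L) :
    cellExt a x y z = 0 := dif_neg h

lemma cellExt_add (a b : Config L) (x y z : ℤ) :
    cellExt (a + b) x y z = cellExt a x y z + cellExt b x y z := by
  unfold cellExt; split_ifs <;> simp

/-- The sum over the six nearest neighbours. -/
def nnSum (f : ℤ → ℤ → ℤ → ZMod 2) (x y z : ℤ) : ZMod 2 :=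
  f (x + 1) y z + f (x - 1) y z + (f x (y + 1) z + f x (y - 1) z) +
    (f x y (z + 1) + f x y (z - 1))

/-- The six nearest neighbours. -/
def nnCells (x y z : ℤ) : Finset Cell :=
  {(x + 1, y, z), (x - 1, y, z), (x, y + 1, z), (x, y - 1, z), (x, y, z + 1), (x, y, z - 1)}

lemma mem_nnCells {x y z x' y' z' : ℤ} : (x', y', z') ∈ nnCells x y z ↔
    ((x' = x + 1 ∨ x' = x - 1) ∧ y' = y ∧ z' = z) ∨ ((y' = y + 1 ∨ y' = y - 1) ∧ x' = x ∧ z' = z) ∨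
      ((z' = z + 1 ∨ z' = z - 1) ∧ x' = x ∧ y' = y) := by
  simp only [nnCells, mem_insert, mem_singleton, Prod.mk.injEq]
  tauto

lemma sum_nnCells (f : ℤ → ℤ → ℤ → ZMod 2) (x y z : ℤ) :
    ∑ c ∈ nnCells x y z, f c.1 c.2.1 c.2.2 = nnSum f x y z := by
  unfold nnCells nnSum
  rw [sum_insert, sum_insert, sum_insert, sum_insert, sum_insert, sum_singleton]
  · ring
  all_goals simp only [mem_insert, mem_singleton, Prod.mk.injEq]; omega

lemma nnSum_add (f g : ℤ → ℤ → ℤ → ZMod 2) (x y z : ℤ) :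
    nnSum (fun x y z => f x y z + g x y z) x y z = nnSum f x y z + nnSum g x y z := by
  unfold nnSum; ring

/-- In characteristic two, the iterated neighbour sum only sees the six cells at distance two along
the axes. -/
lemma nnSum_nnSum (f : ℤ → ℤ → ℤ → ZMod 2) (x y z : ℤ) :
    nnSum (nnSum f) x y z = f (x + 2) y z + f (x - 2) y z + (f x (y + 2) z + f x (y - 2) z) +
      (f x y (z + 2) + f x y (z - 2)) := by
  have h2 : (2 : ZMod 2) = 0 := rfl
  simp only [nnSum, add_sub_cancel_right, sub_add_cancel, add_assoc, sub_sub,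
    show (1 : ℤ) + 1 = 2 from rfl]
  ring_nf
  simp only [h2, mul_zero, add_zero,
    show (6 : ZMod 2) = 0 from rfl]

/-- Cells of `T` without a qubit contribute zero, so sums over qubits can be written over a fixed
geometric pattern with no case distinction at the boundary. -/
lemma sum_eq_sum_cellExt (a : Config L) {S : Finset (Qubit L)} {T : Finset Cell}
    (h : ∀ i, i ∈ S ↔ i.1 ∈ T) : ∑ i ∈ S, a i = ∑ c ∈ T, cellExt a c.1 c.2.1 c.2.2 := by
  have h1 : ∑ i ∈ S, a i = ∑ c ∈ S.map (Function.Embedding.subtype _),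
      cellExt a c.1 c.2.1 c.2.2 := by
    rw [sum_map]
    exact sum_congr rfl fun i _ => (cellExt_of_mem a i.2).symm
  rw [h1]
  refine sum_subset (fun c hc => ?_) fun c hc hc' => cellExt_eq_zero a fun hq => hc' ?_
  · obtain ⟨i, hi, rfl⟩ := mem_map.1 hc
    exact (h i).1 hi
  · exact mem_map.2 ⟨⟨c, hq⟩, (h _).2 hc, rfl⟩

lemma nnCells_symm {x y z x' y' z' : ℤ} :
    (x', y', z') ∈ nnCells x y z ↔ (x, y, z) ∈ nnCells x' y' z' := by
  simp only [mem_nnCells]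
  constructor <;> rintro (⟨h | h, rfl, rfl⟩ | ⟨h | h, rfl, rfl⟩ | ⟨h | h, rfl, rfl⟩) <;> omega

lemma eq_or_dim_lt_of_inside {x y z x' y' z' : ℤ} (h : Inside (x, y, z) (x', y', z')) :
    (x, y, z) = (x', y', z') ∨ x % 2 + y % 2 + z % 2 < x' % 2 + y' % 2 + z' % 2 := by
  rw [inside_iff] at h
  rw [Prod.mk.injEq, Prod.mk.injEq]
  obtain ⟨rfl | ⟨h1, rfl | rfl⟩, rfl | ⟨h2, rfl | rfl⟩, rfl | ⟨h3, rfl | rfl⟩⟩ := h <;> omega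

lemma inside_iff_mem_nnCells {x y z x' y' z' : ℤ}
    (hd : x' % 2 + y' % 2 + z' % 2 = x % 2 + y % 2 + z % 2 + 1) :
    Inside (x, y, z) (x', y', z') ↔ (x, y, z) ∈ nnCells x' y' z' := by
  rw [inside_iff, mem_nnCells]
  constructor
  · rintro ⟨rfl | ⟨h1, rfl | rfl⟩, rfl | ⟨h2, rfl | rfl⟩, rfl | ⟨h3, rfl | rfl⟩⟩ <;> omega
  · rintro (⟨rfl | rfl, rfl, rfl⟩ | ⟨rfl | rfl, rfl, rfl⟩ | ⟨rfl | rfl, rfl, rfl⟩) <;> omega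

lemma dim_of_mem_nnCells {x y z x' y' z' : ℤ} (h : (x, y, z) ∈ nnCells x' y' z') :
    x' % 2 + y' % 2 + z' % 2 = x % 2 + y % 2 + z % 2 + 1 ∨
      x % 2 + y % 2 + z % 2 = x' % 2 + y' % 2 + z' % 2 + 1 := by
  rw [mem_nnCells] at h
  obtain ⟨rfl | rfl, rfl, rfl⟩ | ⟨rfl | rfl, rfl, rfl⟩ | ⟨rfl | rfl, rfl, rfl⟩ := h <;> omega

/-- Qubits have dimension 1 or 2 only, so for distinct qubits containment means a dimension gap of
one, which is adjacency of centres. -/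
lemma mem_nbrs (i j : Qubit L) : j ∈ nbrs i ↔ j.1 ∈ nnCells i.1.1 i.1.2.1 i.1.2.2 := by
  obtain ⟨⟨x, y, z⟩, hi⟩ := i
  obtain ⟨⟨x', y', z'⟩, hj⟩ := j
  have hi2 := (mem_qubitSites.1 hi).2
  have hj2 := (mem_qubitSites.1 hj).2
  simp only [nbrs, mem_filter, mem_univ, true_and, ne_eq, Subtype.mk.injEq]
  constructor
  · rintro ⟨h1, h2 | h2⟩
    · have h3 := (eq_or_dim_lt_of_inside h2).resolve_left h1
      exact (inside_iff_mem_nnCells (by omega)).1 h2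
    · have h3 := (eq_or_dim_lt_of_inside h2).resolve_left (Ne.symm h1)
      exact nnCells_symm.1 ((inside_iff_mem_nnCells (by omega)).1 h2)
  · intro h
    have h3 := dim_of_mem_nnCells h
    refine ⟨?_, ?_⟩
    · rintro ⟨⟩; omega
    · rcases h3 with h3 | h3
      · exact Or.inl ((inside_iff_mem_nnCells h3).2 h)
      · exact Or.inr ((inside_iff_mem_nnCells h3).2 (nnCells_symm.1 h))

lemma sum_nbrs (a : Config L) {x y z : ℤ} (h : (x, y, z) ∈ qubitSites L) :
    ∑ j ∈ nbrs ⟨(x, y, z), h⟩, a j = nnSum (cellExt a) x y z := by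
  rw [sum_eq_sum_cellExt a (mem_nbrs _), sum_nnCells]

/-! ### The terms of the Hamiltonian and the symmetries as binary vectors -/

/-- The vector of the cluster term. -/
def clusterVec (i : Qubit L) : PauliVec L := (ind {i}, ind (nbrs i))

/-- The vector of the dressed star term. -/
def starVec (L : Dims) (v : Cell) : PauliVec L :=
  (ind (toricStar v),
    ind (univ.filter fun f => cellDim f.1 = 2 ∧ ∃ e ∈ toricStar (L := L) v, Inside e.1 f.1))

/-- The vector of the plaquette term. -/
def plaquetteVec (L : Dims) (f : Cell) : PauliVec L :=
  (0, ind (univ.filter fun e => cellDim e.1 = 1 ∧ Inside e.1 f))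

lemma clusterTerm_eq (i : Qubit L) : clusterTerm i = pauli (clusterVec i) := opX_mul_opZ _ _

lemma starTerm_eq (v : Cell) : starTerm L v = pauli (starVec L v) := opX_mul_opZ _ _

lemma plaquetteTerm_eq (f : Cell) : plaquetteTerm L f = pauli (plaquetteVec L f) := opZ_eq_pauli _

/-- The syndrome of a Pauli operator: its commutation form with the cluster operator of a cell,
extended to all cells of the ambient lattice. -/
def syndrome (p : PauliVec L) (x y z : ℤ) : ZMod 2 :=
  cellExt p.2 x y z + nnSum (cellExt p.1) x y z

lemma syndrome_add (p q : PauliVec L) (x y z : ℤ) :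
    syndrome (p + q) x y z = syndrome p x y z + syndrome q x y z := by
  simp only [syndrome, Prod.fst_add, Prod.snd_add, cellExt_add, nnSum]; ring

lemma comm_clusterVec (p : PauliVec L) {x y z : ℤ} (h : (x, y, z) ∈ qubitSites L) :
    comm p (clusterVec ⟨(x, y, z), h⟩) = syndrome p x y z := by
  simp only [comm, clusterVec, dotProduct_ind, ind_dotProduct, sum_singleton, sum_nbrs, syndrome,
    cellExt_of_mem _ h]

lemma mem_toricStar (i : Qubit L) {y z : ℤ} (hy : y % 2 = 0) (hz : z % 2 = 0) :
    i ∈ toricStar (L := L) (0, y, z) ↔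
      i.1 ∈ ({(0, y + 1, z), (0, y - 1, z), (0, y, z + 1), (0, y, z - 1)} : Finset Cell) := by
  obtain ⟨⟨x', y', z'⟩, hi⟩ := i
  simp only [toricStar, mem_filter, mem_univ, true_and, inside_iff, mem_insert, mem_singleton,
    Prod.mk.injEq, cellDim]
  constructor
  · rintro ⟨h1, h2, h3, h4, h5⟩; omega
  · intro h; omega

lemma mem_starFaces (i : Qubit L) {y z : ℤ} (hv : (0, y, z) ∈ vertices L) :
    (cellDim i.1 = 2 ∧ ∃ e ∈ toricStar (L := L) (0, y, z), Inside e.1 i.1) ↔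
      i.1 ∈ ({(1, y + 1, z), (1, y - 1, z), (1, y, z + 1), (1, y, z - 1)} : Finset Cell) := by
  rw [mem_vertices] at hv
  have hy : y % 2 = 0 := by omega
  have hz : z % 2 = 0 := by omega
  constructor
  · rintro ⟨h1, e, he, h2⟩
    rw [mem_toricStar e hy hz] at he
    obtain ⟨⟨x', y', z'⟩, hi⟩ := i
    obtain ⟨⟨x₁, y₁, z₁⟩, hj⟩ := e
    have hi2 := (mem_qubitSites.1 hi).2
    have hj2 := (mem_qubitSites.1 hj).2
    simp only [mem_insert, mem_singleton, Prod.mk.injEq, cellDim] at he h1 ⊢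
    have h3 := mem_nnCells.1 (nnCells_symm.1 ((inside_iff_mem_nnCells (by omega)).1 h2))
    have hi1 := (mem_qubitSites.1 hi).1.1.1
    clear h2 hj2 hv hi hj
    obtain ⟨rfl, rfl, rfl⟩ | ⟨rfl, rfl, rfl⟩ | ⟨rfl, rfl, rfl⟩ | ⟨rfl, rfl, rfl⟩ := he <;>
      obtain ⟨rfl | rfl, rfl, rfl⟩ | ⟨rfl | rfl, rfl, rfl⟩ | ⟨rfl | rfl, rfl, rfl⟩ := h3 <;> omega
  · intro h
    obtain ⟨⟨x', y', z'⟩, hi⟩ := i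
    rw [mem_qubitSites] at hi
    simp only [mem_insert, mem_singleton, Prod.mk.injEq] at h
    have hx : x' = 1 := by omega
    refine ⟨by simp only [cellDim]; omega, ⟨(0, y', z'), ?_⟩, ?_, ?_⟩
    · rw [mem_qubitSites]; omega
    · rw [mem_toricStar _ hy hz]
      simp only [mem_insert, mem_singleton, Prod.mk.injEq, true_and]; omega
    · rw [inside_iff]; omega

lemma comm_starVec (p : PauliVec L) {y z : ℤ} (hv : (0, y, z) ∈ vertices L) :
    comm p (starVec L (0, y, z)) =
      (cellExt p.2 0 (y + 1) z + cellExt p.1 1 (y + 1) z) +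
      (cellExt p.2 0 (y - 1) z + cellExt p.1 1 (y - 1) z) +
      (cellExt p.2 0 y (z + 1) + cellExt p.1 1 y (z + 1)) +
      (cellExt p.2 0 y (z - 1) + cellExt p.1 1 y (z - 1)) := by
  have hv' := mem_vertices.1 hv
  simp only [comm, starVec, dotProduct_ind, ind_dotProduct]
  rw [sum_eq_sum_cellExt p.2 fun i => mem_toricStar i (by omega) (by omega),
    sum_eq_sum_cellExt p.1 fun i => by
      rw [mem_filter, ← mem_starFaces i hv]; exact and_iff_right (mem_univ _)]
  rw [sum_insert, sum_insert, sum_insert, sum_singleton, sum_insert, sum_insert, sum_insert,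
    sum_singleton]
  · ring
  all_goals simp only [mem_insert, mem_singleton, Prod.mk.injEq]; omega

/-- A face of the toric facet carries no qubit, so its syndrome has only the neighbour sum of the
`X` part. Plaquettes thus enter the same conservation law as cluster terms. -/
lemma comm_plaquetteVec (p : PauliVec L) {y z : ℤ} (hf : (0, y, z) ∈ faces L) :
    comm p (plaquetteVec L (0, y, z)) = syndrome p 0 y z := by
  rw [mem_faces] at hf
  simp only [comm, plaquetteVec, dotProduct_zero, zero_add, ind_dotProduct, syndrome]
  rw [cellExt_eq_zero p.2 (by rw [mem_qubitSites]; omega), zero_add, ← sum_nnCells]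
  refine sum_eq_sum_cellExt _ fun i => ?_
  obtain ⟨⟨x', y', z'⟩, hi⟩ := i
  rw [mem_qubitSites] at hi
  simp only [mem_filter, mem_univ, true_and, cellDim]
  constructor
  · rintro ⟨h1, h2⟩
    exact (inside_iff_mem_nnCells (by omega)).1 h2
  · intro h
    have h1 := dim_of_mem_nnCells h
    exact ⟨by omega, (inside_iff_mem_nnCells (by omega)).2 h⟩

/-- The vector of the symmetry generator at a vertex. -/
lemma symV_eq (v : Cell) :
    symV L v = pauli (ind (univ.filter fun e => cellDim e.1 = 1 ∧ Inside v e.1), 0) :=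
  opX_eq_pauli _

lemma symQ_eq (q : Cell) :
    symQ L q = pauli (ind (univ.filter fun f => cellDim f.1 = 2 ∧ Inside f.1 q), 0) :=
  opX_eq_pauli _

lemma nnSum_eq_zero_of_commute_symV {c : ℂ} (hc : c ≠ 0) {p : PauliVec L} {x y z : ℤ}
    (hv : (x, y, z) ∈ vertices L) (h : Commute (c • pauli p) (symV L (x, y, z))) :
    nnSum (cellExt p.2) x y z = 0 := by
  rw [symV_eq] at h
  have h1 := comm_eq_zero_of_commute hc h
  simp only [comm, zero_dotProduct, add_zero, dotProduct_ind] at h1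
  rw [← h1, ← sum_nnCells]
  refine (sum_eq_sum_cellExt _ fun i => ?_).symm
  rw [mem_vertices] at hv
  obtain ⟨⟨x', y', z'⟩, hi⟩ := i
  simp only [mem_filter, mem_univ, true_and, cellDim]
  constructor
  · rintro ⟨h1, h2⟩
    exact nnCells_symm.1 ((inside_iff_mem_nnCells (by omega)).1 h2)
  · intro h
    have h1 := dim_of_mem_nnCells h
    exact ⟨by omega, (inside_iff_mem_nnCells (by omega)).2 (nnCells_symm.1 h)⟩

lemma nnSum_eq_zero_of_commute_symQ {c : ℂ} (hc : c ≠ 0) {p : PauliVec L} {x y z : ℤ}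
    (hq : (x, y, z) ∈ cubes L) (h : Commute (c • pauli p) (symQ L (x, y, z))) :
    nnSum (cellExt p.2) x y z = 0 := by
  rw [symQ_eq] at h
  have h1 := comm_eq_zero_of_commute hc h
  simp only [comm, zero_dotProduct, add_zero, dotProduct_ind] at h1
  rw [← h1, ← sum_nnCells]
  refine (sum_eq_sum_cellExt _ fun i => ?_).symm
  rw [mem_cubes] at hq
  obtain ⟨⟨x', y', z'⟩, hi⟩ := i
  simp only [mem_filter, mem_univ, true_and, cellDim]
  constructor
  · rintro ⟨h1, h2⟩
    exact (inside_iff_mem_nnCells (by omega)).1 h2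
  · intro h
    have h1 := dim_of_mem_nnCells h
    exact ⟨by omega, (inside_iff_mem_nnCells (by omega)).2 h⟩

lemma cellExt_ind_eq_zero {S : Finset (Qubit L)} {x y z : ℤ}
    (h : ∀ h : (x, y, z) ∈ qubitSites L, (⟨(x, y, z), h⟩ : Qubit L) ∉ S) :
    cellExt (ind S) x y z = 0 := by
  by_cases hq : (x, y, z) ∈ qubitSites L
  · rw [cellExt_of_mem _ hq]; exact if_neg (h hq)
  · exact cellExt_eq_zero _ hq

lemma cellExt_zero (x y z : ℤ) : cellExt (0 : Config L) x y z = 0 := by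
  unfold cellExt; split_ifs <;> rfl

/-! ### Commutation of the terms -/

lemma comm_clusterVec_clusterVec (i j : Qubit L) : comm (clusterVec i) (clusterVec j) = 0 := by
  have h : j ∈ nbrs i ↔ i ∈ nbrs j := by rw [mem_nbrs, mem_nbrs]; exact nnCells_symm
  simp only [comm, clusterVec, dotProduct_ind, sum_singleton, ind, h]
  exact CharTwo.add_self_eq_zero _

/-- The only qubit adjacent to a facet edge is the face standing on it, so the two contributions to
a star term cancel edge by edge. This holds for facet qubits `i` as well. -/
lemma cellExt_nbrs_facet (i : Qubit L) {y z : ℤ} (hd : y % 2 + z % 2 = 1) (hz : 1 ≤ z)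
    (hz' : z ≤ 2 * L.z - 1) :
    cellExt (ind (nbrs i)) 0 y z + cellExt (ind {i}) 1 y z = 0 := by
  by_cases hc : i.1 = (1, y, z)
  · have hq : ((0 : ℤ), y, z) ∈ qubitSites L := by
      have := i.2
      rw [hc, mem_qubitSites] at this
      rw [mem_qubitSites]; omega
    rw [cellExt_of_mem _ hq, cellExt_of_mem _ (hc ▸ i.2)]
    simp only [ind, mem_nbrs, hc, mem_singleton]
    rw [if_pos (by rw [mem_nnCells]; omega), if_pos (Subtype.ext hc.symm)]
    rfl
  · rw [cellExt_ind_eq_zero, cellExt_ind_eq_zero, add_zero]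
    · intro h hm
      rw [mem_singleton] at hm
      exact hc (by rw [← hm])
    · intro h hm
      rw [mem_nbrs] at hm
      obtain ⟨⟨x', y', z'⟩, hi⟩ := i
      have hn : (x', y', z') ∈ nnCells 0 y z := nnCells_symm.1 hm
      rw [mem_nnCells] at hn
      rw [Prod.mk.injEq, Prod.mk.injEq] at hc
      replace hi := mem_qubitSites.1 hi
      clear hm
      obtain ⟨rfl | rfl, rfl, rfl⟩ | ⟨rfl | rfl, rfl, rfl⟩ | ⟨rfl | rfl, rfl, rfl⟩ := hn <;> omega

lemma comm_clusterVec_starVec (i : Qubit L) {y z : ℤ} (hv : (0, y, z) ∈ vertices L) :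
    comm (clusterVec i) (starVec L (0, y, z)) = 0 := by
  rw [comm_starVec _ hv]
  rw [mem_vertices] at hv
  simp only [clusterVec]
  rw [cellExt_nbrs_facet, cellExt_nbrs_facet, cellExt_nbrs_facet, cellExt_nbrs_facet] <;>
    first | rfl | omega

lemma comm_clusterVec_plaquetteVec (i : Qubit L) (hi : 0 < i.1.1) {y z : ℤ} :
    comm (clusterVec i) (plaquetteVec L (0, y, z)) = 0 := by
  obtain ⟨⟨x', y', z'⟩, hi'⟩ := i
  simp only [comm, clusterVec, plaquetteVec, dotProduct_zero, zero_add, dotProduct_ind,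
    sum_singleton]
  refine if_neg fun hm => ?_
  simp only [mem_filter, inside_iff] at hm hi
  omega

lemma comm_starVec_starVec {y z y' z' : ℤ} (hv : (0, y, z) ∈ vertices L)
    (hv' : (0, y', z') ∈ vertices L) :
    comm (starVec L (0, y, z)) (starVec L (0, y', z')) = 0 := by
  have hvm := mem_vertices.1 hv
  have h1 (b c : ℤ) : cellExt (starVec L (0, y, z)).1 1 b c = 0 := by
    refine cellExt_ind_eq_zero fun h hm => ?_
    rw [mem_toricStar _ (by omega) (by omega)] at hm
    simp at hm
  have h2 (b c : ℤ) : cellExt (starVec L (0, y, z)).2 0 b c = 0 := by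
    refine cellExt_ind_eq_zero fun h hm => ?_
    rw [mem_filter, mem_starFaces _ hv] at hm
    simp at hm
  simp only [comm_starVec _ hv', h1, h2, add_zero]

lemma cellExt_plaquetteVec {y z b c : ℤ} (hf : (0, y, z) ∈ faces L)
    (hd : b % 2 + c % 2 = 1) (hb : 0 ≤ b) (hb' : b ≤ 2 * L.y) (hc : 1 ≤ c)
    (hc' : c ≤ 2 * L.z - 1) (hL : 1 ≤ L.x) :
    cellExt (plaquetteVec L (0, y, z)).2 0 b c = if (0, b, c) ∈ nnCells 0 y z then 1 else 0 := by
  rw [mem_faces] at hf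
  have hq : ((0 : ℤ), b, c) ∈ qubitSites L := by rw [mem_qubitSites]; omega
  rw [cellExt_of_mem _ hq]
  simp only [plaquetteVec, ind, mem_filter, mem_univ, true_and, cellDim]
  refine if_congr ?_ rfl rfl
  rw [inside_iff_mem_nnCells (by omega)]
  exact and_iff_right (by omega)

lemma cellExt_plaquetteVec_eq_zero {y z b c : ℤ} (h : (0, b, c) ∉ qubitSites L) :
    cellExt (plaquetteVec L (0, y, z)).2 0 b c = 0 := cellExt_eq_zero _ h

/-- A facet vertex and a facet face share either no edge or two, one in each direction. -/
lemma comm_plaquetteVec_starVec {y z y' z' : ℤ} (hf : (0, y', z') ∈ faces L)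
    (hv : (0, y, z) ∈ vertices L) :
    comm (plaquetteVec L (0, y', z')) (starVec L (0, y, z)) = 0 := by
  rw [comm_starVec _ hv]
  have hv' := mem_vertices.1 hv
  have hf' := mem_faces.1 hf
  have h0 (b c : ℤ) : cellExt (plaquetteVec L (0, y', z')).1 1 b c = 0 := cellExt_zero _ _ _
  have hy1 : cellExt (plaquetteVec L (0, y', z')).2 0 (y + 1) z =
      if y + 1 = y' ∧ (z = z' + 1 ∨ z = z' - 1) then 1 else 0 := by
    by_cases hb : y + 1 ≤ 2 * L.y
    · rw [cellExt_plaquetteVec hf] <;> try omega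
      refine if_congr ?_ rfl rfl
      rw [mem_nnCells]; omega
    · rw [cellExt_plaquetteVec_eq_zero (by rw [mem_qubitSites]; omega), if_neg (by omega)]
  have hy2 : cellExt (plaquetteVec L (0, y', z')).2 0 (y - 1) z =
      if y - 1 = y' ∧ (z = z' + 1 ∨ z = z' - 1) then 1 else 0 := by
    by_cases hb : 0 ≤ y - 1
    · rw [cellExt_plaquetteVec hf] <;> try omega
      refine if_congr ?_ rfl rfl
      rw [mem_nnCells]; omega
    · rw [cellExt_plaquetteVec_eq_zero (by rw [mem_qubitSites]; omega), if_neg (by omega)]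
  have hz1 : cellExt (plaquetteVec L (0, y', z')).2 0 y (z + 1) =
      if z + 1 = z' ∧ (y = y' + 1 ∨ y = y' - 1) then 1 else 0 := by
    rw [cellExt_plaquetteVec hf] <;> try omega
    refine if_congr ?_ rfl rfl
    rw [mem_nnCells]; omega
  have hz2 : cellExt (plaquetteVec L (0, y', z')).2 0 y (z - 1) =
      if z - 1 = z' ∧ (y = y' + 1 ∨ y = y' - 1) then 1 else 0 := by
    rw [cellExt_plaquetteVec hf] <;> try omega
    refine if_congr ?_ rfl rfl
    rw [mem_nnCells]; omega
  simp only [h0, hy1, hy2, hz1, hz2, add_zero]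
  clear hy1 hy2 hz1 hz2 h0 hf hv hv' hf'
  split_ifs <;> first | rfl | (exfalso; omega)

lemma comm_plaquetteVec_plaquetteVec (f f' : Cell) :
    comm (plaquetteVec L f) (plaquetteVec L f') = 0 := by
  simp [comm, plaquetteVec]

/-- The index set of the terms of the Hamiltonian: bulk qubits, and vertices and faces of the toric
code facet. -/
abbrev Term (L : Dims) :=
  {i : Qubit L // 0 < i.1.1} ⊕ {v : Cell // v ∈ vertices L ∧ v.1 = 0} ⊕
    {f : Cell // f ∈ faces L ∧ f.1 = 0}

instance : Fintype {v : Cell // v ∈ vertices L ∧ v.1 = 0} :=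
  Fintype.ofFinset ((vertices L).filter fun v => v.1 = 0) fun _ => mem_filter

instance : Fintype {f : Cell // f ∈ faces L ∧ f.1 = 0} :=
  Fintype.ofFinset ((faces L).filter fun f => f.1 = 0) fun _ => mem_filter

/-- The vectors of the terms of the Hamiltonian. -/
def termVec : Term L → PauliVec L
  | .inl i => clusterVec i.1
  | .inr (.inl v) => starVec L v.1
  | .inr (.inr f) => plaquetteVec L f.1

lemma hamiltonian_eq (L : Dims) : hamiltonian L = -∑ t : Term L, pauli (termVec t) := by
  rw [hamiltonian, Fintype.sum_sum_type, Fintype.sum_sum_type,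
    sum_subtype (p := fun i : Qubit L => 0 < i.1.1) _ (fun i => by simp),
    sum_subtype (p := fun v : Cell => v ∈ vertices L ∧ v.1 = 0) _ (fun i => mem_filter),
    sum_subtype (p := fun v : Cell => v ∈ faces L ∧ v.1 = 0) _ (fun i => mem_filter)]
  simp only [termVec, clusterTerm_eq, starTerm_eq, plaquetteTerm_eq]
  abel

lemma comm_clusterVec_termVec (i : Qubit L) (hi : 0 < i.1.1) (t : Term L) :
    comm (clusterVec i) (termVec t) = 0 := by
  obtain j | ⟨⟨x, y, z⟩, hv, rfl : x = 0⟩ | ⟨⟨x, y, z⟩, hv, rfl : x = 0⟩ := t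
  · exact comm_clusterVec_clusterVec _ _
  · exact comm_clusterVec_starVec _ hv
  · exact comm_clusterVec_plaquetteVec _ hi

lemma comm_starVec_termVec {y z : ℤ} (hv : (0, y, z) ∈ vertices L) (t : Term L) :
    comm (starVec L (0, y, z)) (termVec t) = 0 := by
  obtain j | ⟨⟨x, y', z'⟩, hv', rfl : x = 0⟩ | ⟨⟨x, y', z'⟩, hv', rfl : x = 0⟩ := t
  · rw [comm_symm]; exact comm_clusterVec_starVec _ hv
  · exact comm_starVec_starVec hv hv'
  · rw [comm_symm]; exact comm_plaquetteVec_starVec hv' hv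

lemma comm_plaquetteVec_termVec {y z : ℤ} (hf : (0, y, z) ∈ faces L) (t : Term L) :
    comm (plaquetteVec L (0, y, z)) (termVec t) = 0 := by
  obtain j | ⟨⟨x, y', z'⟩, hv', rfl : x = 0⟩ | ⟨⟨x, y', z'⟩, hv', rfl : x = 0⟩ := t
  · rw [comm_symm]; exact comm_clusterVec_plaquetteVec _ j.2
  · exact comm_plaquetteVec_starVec hf hv'
  · exact comm_plaquetteVec_plaquetteVec _ _

lemma comm_termVec (s t : Term L) : comm (termVec s) (termVec t) = 0 := by
  obtain j | ⟨⟨x, y, z⟩, hv, rfl : x = 0⟩ | ⟨⟨x, y, z⟩, hv, rfl : x = 0⟩ := s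
  · exact comm_clusterVec_termVec _ j.2 t
  · exact comm_starVec_termVec hv t
  · exact comm_plaquetteVec_termVec hv t

lemma termVec_commute (s t : Term L) :
    pauli (termVec s) * pauli (termVec t) = pauli (termVec t) * pauli (termVec s) := by
  rw [pauli_mul_comm, comm_termVec, sgn_zero, one_smul]

lemma termVec_sq (t : Term L) : pauli (termVec t) * pauli (termVec t) = 1 := by
  suffices h : (termVec t).2 ⬝ᵥ (termVec t).1 = 0 by rw [pauli_mul_self, h, sgn_zero, one_smul]
  obtain j | v | f := t
  · simp only [termVec, clusterVec, dotProduct_ind, sum_singleton]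
    exact if_neg fun h => (mem_filter.1 h).2.1 rfl
  · simp only [termVec, starVec, dotProduct_ind]
    refine sum_eq_zero fun i hi => if_neg fun hi' => ?_
    have h1 := (mem_filter.1 hi).2.1
    have h2 := (mem_filter.1 hi').2.1
    omega
  · simp [termVec, plaquetteVec]

/-! ### The ground space and the spectrum -/

lemma term_apply_pauli (p : PauliVec L) {t : Term L} {σ : ZMod 2} {φ : QState L}
    (h : pauli (termVec t) φ = sgn σ • φ) :
    pauli (termVec t) (pauli p φ) = sgn (σ + comm p (termVec t)) • pauli p φ := by
  rw [← Module.End.mul_apply, pauli_mul_comm, LinearMap.smul_apply, Module.End.mul_apply, h,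
    map_smul, smul_smul, comm_symm, sgn_add, mul_comm]

/-- A `Z` type operator with prescribed commutation with the cluster and star terms. -/
lemma exists_Z_correction (σ : Term L → ZMod 2) (hσ : ∀ f, σ (.inr (.inr f)) = 0) :
    ∃ p : PauliVec L, ∀ t, comm p (termVec t) = σ t := by
  classical
  set τ : ℤ → ℤ → ZMod 2 := fun y z =>
    if h : (0, y, z) ∈ vertices L then σ (.inr (.inl ⟨(0, y, z), h, rfl⟩)) else 0 with hτ
  -- A single `Z` off the facet flips its own cluster term. On the facet, partial sums along each
  -- column starting at the rough edge `z = 0` make consecutive edges differ by `τ` at the vertex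
  -- between them; the `k = 0` term vanishes since no vertex lies there.
  set b : Config L := fun i => if h : 0 < i.1.1 then σ (.inl ⟨i, h⟩) else
    if i.1.2.1 % 2 = 0 then ∑ k ∈ range (i.1.2.2.toNat / 2 + 1), τ i.1.2.1 (2 * k) else 0 with hb
  refine ⟨(0, b), fun t => ?_⟩
  obtain ⟨⟨⟨x, y, z⟩, hq⟩, hi⟩ | ⟨⟨x, y, z⟩, hv, rfl : x = 0⟩ | f := t
  · simp only [termVec, comm, clusterVec, dotProduct_ind, sum_singleton, dotProduct_zero, add_zero]
    exact dif_pos hi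
  · have hv' := mem_vertices.1 hv
    simp only [termVec]
    have h0 (c d : ℤ) (hc : c % 2 = 1) : cellExt b 0 c d = 0 := by
      unfold cellExt
      split_ifs with h
      · simp only [hb]
        rw [dif_neg (by omega), if_neg (by omega)]
      · rfl
    have h1 (n : ℕ) (hn : n < L.z) :
        cellExt b 0 y (2 * n + 1) = ∑ k ∈ range (n + 1), τ y (2 * k) := by
      rw [cellExt_of_mem _ (by rw [mem_qubitSites]; omega)]
      simp only [hb]
      rw [dif_neg (by omega), if_pos (by omega), show (2 * (n : ℤ) + 1).toNat / 2 = n by omega]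
    obtain ⟨n, rfl⟩ : ∃ n : ℕ, z = 2 * (n + 1 : ℕ) := ⟨(z / 2 - 1).toNat, by omega⟩
    rw [comm_starVec _ hv]
    simp only [cellExt_zero, add_zero]
    rw [h0 _ _ (by omega), h0 _ _ (by omega), h1 (n + 1) (by omega),
      show (2 * ((n + 1 : ℕ) : ℤ) - 1) = 2 * n + 1 by push_cast; ring, h1 n (by omega),
      sum_range_succ _ (n + 1), zero_add, zero_add, add_right_comm, CharTwo.add_self_eq_zero,
      zero_add]
    exact dif_pos hv
  · rw [hσ]
    simp [termVec, comm, plaquetteVec]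

/-- `Z` type operators cannot repair plaquettes, so the search is confined to the joint `+1`
eigenspace of the plaquettes, which contains the all-zero basis state. The remaining signs of a
joint eigenvector there are removed by `exists_Z_correction`. -/
lemma exists_ground_state (L : Dims) :
    ∃ Ω : QState L, Ω ≠ 0 ∧ ∀ t : Term L, pauli (termVec t) Ω = Ω := by
  classical
  set S : Submodule ℂ (QState L) :=
    ⨅ f : {f : Cell // f ∈ faces L ∧ f.1 = 0}, (pauli (plaquetteVec L f.1)).eigenspace 1 with hS
  have hmem (ψ : QState L) : ψ ∈ S ↔ ∀ f : {f : Cell // f ∈ faces L ∧ f.1 = 0},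
      pauli (plaquetteVec L f.1) ψ = ψ := by
    simp [hS, Submodule.mem_iInf]
  obtain ⟨φ, hφ, h0, σ, hσ⟩ := exists_joint_eigenvector (fun t : Term L => pauli (termVec t))
    termVec_commute termVec_sq S (fun t ψ hψ => (hmem _).2 fun f => by
      have := termVec_commute (L := L) (.inr (.inr f)) t
      simp only [termVec] at this ⊢
      rw [← Module.End.mul_apply, this, Module.End.mul_apply, (hmem ψ).1 hψ f])
    (φ := Pi.single 0 1) ((hmem _).2 fun f => by
      funext s
      simp only [pauli_apply, plaquetteVec, add_zero]
      by_cases hs : s = 0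
      · subst hs; simp
      · simp [hs])
    (by intro h; simpa using congrFun h 0) univ
  have hσ0 (f) : σ (.inr (.inr f)) = 0 := by
    have h1 := hσ (.inr (.inr f)) (mem_univ _)
    have h2 : pauli (termVec (.inr (.inr f))) φ = (1 : ℂ) • φ := by
      rw [one_smul]; exact (hmem φ).1 hφ f
    exact sgn_eq_one_iff.1 (smul_left_injective ℂ h0 (h1.symm.trans h2))
  obtain ⟨p, hp⟩ := exists_Z_correction σ hσ0
  refine ⟨pauli p φ, fun h => h0 (pauli_injective p (h.trans (map_zero _).symm)), fun t => ?_⟩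
  rw [term_apply_pauli p (hσ t (mem_univ t)), hp, CharTwo.add_self_eq_zero, sgn_zero, one_smul]

lemma hasEigenvector_pauli {c : ℂ} (hc : c ≠ 0) (p : PauliVec L) {ψ : QState L} (h0 : ψ ≠ 0)
    (hψ : ∀ t : Term L, pauli (termVec t) ψ = ψ) :
    (hamiltonian L).HasEigenvector ((-(Fintype.card (Term L) : ℝ) +
      2 * minusCount (fun t : Term L => comm p (termVec t)) : ℝ) : ℂ) ((c • pauli p) ψ) := by
  rw [Module.End.hasEigenvector_iff, Module.End.mem_eigenspace_iff, hamiltonian_eq]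
  refine ⟨neg_sum_apply fun t => ?_, ?_⟩
  · rw [LinearMap.smul_apply, map_smul, term_apply_pauli (σ := 0) p (by simp [hψ]), zero_add,
      smul_comm]
  · rw [LinearMap.smul_apply]
    exact smul_ne_zero hc fun h => h0 (pauli_injective p (h.trans (map_zero _).symm))

lemma energy_of_hasEigenvalue {E : ℝ} (h : (hamiltonian L).HasEigenvalue (E : ℂ)) :
    ∃ n : ℕ, E = -(Fintype.card (Term L) : ℝ) + 2 * n := by
  obtain ⟨φ, hφ⟩ := h.exists_hasEigenvector
  rw [Module.End.hasEigenvector_iff, Module.End.mem_eigenspace_iff, hamiltonian_eq] at hφ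
  obtain ⟨_, _, _, σ, _, h⟩ := exists_sign_pattern (fun t : Term L => pauli (termVec t))
    termVec_commute termVec_sq ⊤ (fun _ _ _ => trivial) trivial hφ.2 hφ.1
  exact ⟨_, h⟩

lemma groundEnergy_eq (L : Dims) :
    groundEnergy (hamiltonian L) = -(Fintype.card (Term L) : ℝ) := by
  refine IsLeast.csInf_eq ⟨?_, fun E hE => ?_⟩
  · obtain ⟨Ω, h0, hΩ⟩ := exists_ground_state L
    have := hasEigenvector_pauli one_ne_zero 0 h0 hΩ
    simp only [comm_zero_left, minusCount] at this
    simpa using Module.End.hasEigenvalue_of_hasEigenvector this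
  · obtain ⟨n, rfl⟩ := energy_of_hasEigenvalue hE
    have : (0 : ℝ) ≤ n := n.cast_nonneg
    linarith

lemma mem_groundSpace {ψ : QState L} :
    ψ ∈ groundSpace (hamiltonian L) ↔ ∀ t : Term L, pauli (termVec t) ψ = ψ := by
  rw [groundSpace, Module.End.mem_eigenspace_iff, groundEnergy_eq, hamiltonian_eq]
  exact neg_sum_apply_eq_iff termVec_commute termVec_sq

lemma hasEnergy_pauli {c : ℂ} (hc : c ≠ 0) (p : PauliVec L) :
    HasEnergy (hamiltonian L) (c • pauli p) (-(Fintype.card (Term L) : ℝ) +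
      2 * minusCount (fun t : Term L => comm p (termVec t))) :=
  fun _ hψ h0 => hasEigenvector_pauli hc p h0 (mem_groundSpace.1 hψ)

lemma energyGap_eq (hx : 1 ≤ L.x) (hz : 2 ≤ L.z) : energyGap (hamiltonian L) = 2 := by
  rw [energyGap, groundEnergy_eq]
  suffices h : IsLeast {E : ℝ | (hamiltonian L).HasEigenvalue (E : ℂ) ∧
      -(Fintype.card (Term L) : ℝ) < E} (-(Fintype.card (Term L) : ℝ) + 2) by
    rw [h.csInf_eq]; ring
  refine ⟨⟨?_, by linarith⟩, fun E hE => ?_⟩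
  · obtain ⟨Ω, h0, hΩ⟩ := exists_ground_state L
    -- A single `Z` off the facet violates only its own cluster term. The height 2 lies inside the
    -- lattice because `2 ≤ L.z`.
    have hq : ((1 : ℤ), (0 : ℤ), (2 : ℤ)) ∈ qubitSites L := by rw [mem_qubitSites]; omega
    set i : Qubit L := ⟨(1, 0, 2), hq⟩ with hi
    have h1 := hasEigenvector_pauli one_ne_zero (0, ind {i}) h0 hΩ
    suffices h : minusCount (fun t : Term L => comm (0, ind {i}) (termVec t)) = 1 by
      rw [h, Nat.cast_one, mul_one] at h1
      exact Module.End.hasEigenvalue_of_hasEigenvector h1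
    refine card_eq_one.2 ⟨.inl ⟨i, one_pos⟩, ?_⟩
    ext t
    rw [mem_filter, mem_singleton]
    obtain j | ⟨⟨x, y, z⟩, hv, rfl : x = 0⟩ | f := t
    · simp only [termVec, comm, clusterVec, dotProduct_ind, sum_singleton, dotProduct_zero,
        add_zero, ind, mem_singleton, mem_univ, true_and, Sum.inl.injEq, Subtype.ext_iff]
      split_ifs with h <;> simp [h]
    · have h2 (y z : ℤ) : cellExt (ind {i}) 0 y z = 0 := cellExt_ind_eq_zero fun h hm => by
        simp [hi] at hm
      simp [termVec, comm_starVec _ hv, h2, cellExt_zero]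
    · simp [termVec, comm, plaquetteVec]
  · obtain ⟨n, rfl⟩ := energy_of_hasEigenvalue hE.1
    have h1 : (0 : ℝ) < n := by linarith [hE.2]
    have h2 : (1 : ℝ) ≤ n := by exact_mod_cast h1
    linarith

/-! ### Conservation of the syndrome -/

/-- The `Z` part of a Pauli operator that commutes with the 1-form symmetries is conserved at all
vertices and volumes. -/
structure IsSymVec (p : PauliVec L) : Prop where
  vertex : ∀ x y z, (x, y, z) ∈ vertices L → nnSum (cellExt p.2) x y z = 0
  cube : ∀ x y z, (x, y, z) ∈ cubes L → nnSum (cellExt p.2) x y z = 0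

/-- The doubled neighbour sum of the `X` part reaches only cells at distance two along the axes;
these are again vertices or volumes and carry no qubit. -/
lemma nnSum_syndrome (p : PauliVec L) {x y z : ℤ}
    (hd : x % 2 + y % 2 + z % 2 = 0 ∨ x % 2 + y % 2 + z % 2 = 3) :
    nnSum (syndrome p) x y z = nnSum (cellExt p.2) x y z := by
  have h : nnSum (syndrome p) x y z =
      nnSum (cellExt p.2) x y z + nnSum (nnSum (cellExt p.1)) x y z := nnSum_add _ _ x y z
  rw [h, nnSum_nnSum]
  simp only [add_eq_left]
  rw [cellExt_eq_zero, cellExt_eq_zero, cellExt_eq_zero, cellExt_eq_zero, cellExt_eq_zero,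
    cellExt_eq_zero]
  · simp
  all_goals rw [mem_qubitSites]; omega

lemma nnSum_syndrome_vertex {p : PauliVec L} (hp : IsSymVec p) {x y z : ℤ}
    (hv : (x, y, z) ∈ vertices L) : nnSum (syndrome p) x y z = 0 := by
  rw [nnSum_syndrome p (Or.inl (mem_vertices.1 hv).2.1), hp.vertex _ _ _ hv]

lemma nnSum_syndrome_cube {p : PauliVec L} (hp : IsSymVec p) {x y z : ℤ}
    (hx : -1 ≤ x) (hx' : x < 2 * L.x) (hy : 0 ≤ y) (hy' : y ≤ 2 * L.y) (hz : 1 ≤ z)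
    (hz' : z ≤ 2 * L.z - 1) (hd : x % 2 + y % 2 + z % 2 = 3) : nnSum (syndrome p) x y z = 0 := by
  rw [nnSum_syndrome p (Or.inr hd)]
  -- The fictitious volumes at `x = -1` touch no qubit, so conservation there is automatic. They
  -- extend the flow past the facet: the syndrome on the faces at `x = -1` is the `X` part on the
  -- facet edges.
  by_cases h : x = -1
  · unfold nnSum
    rw [cellExt_eq_zero, cellExt_eq_zero, cellExt_eq_zero, cellExt_eq_zero, cellExt_eq_zero,
      cellExt_eq_zero]
    · simp
    all_goals rw [mem_qubitSites]; omega
  · exact hp.cube _ _ _ (by rw [mem_cubes]; omega)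

lemma syndrome_eq_zero (p : PauliVec L) {x y z : ℤ} (h0 : (x, y, z) ∉ qubitSites L)
    (h1 : (x + 1, y, z) ∉ qubitSites L) (h2 : (x - 1, y, z) ∉ qubitSites L)
    (h3 : (x, y + 1, z) ∉ qubitSites L) (h4 : (x, y - 1, z) ∉ qubitSites L)
    (h5 : (x, y, z + 1) ∉ qubitSites L) (h6 : (x, y, z - 1) ∉ qubitSites L) :
    syndrome p x y z = 0 := by
  simp only [syndrome, nnSum, cellExt_eq_zero _ h0, cellExt_eq_zero _ h1, cellExt_eq_zero _ h2,
    cellExt_eq_zero _ h3, cellExt_eq_zero _ h4, cellExt_eq_zero _ h5, cellExt_eq_zero _ h6,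
    add_zero]

/-! ### Flux through parallel planes -/

lemma sum_range_succ_add_self (g : ℕ → ZMod 2) (m : ℕ) :
    ∑ i ∈ range m, (g (i + 1) + g i) = g m + g 0 := by
  simpa [CharTwo.sub_eq_add] using sum_range_sub g m

/-- A conserved flow that does not leave through the sides has the same flux through both ends. -/
lemma flux_eq {m n : ℕ} {F F' G H : ℕ → ℕ → ZMod 2}
    (h : ∀ i < m, ∀ j < n,
      G (i + 1) j + G i j + (H i (j + 1) + H i j) + (F' i j + F i j) = 0)
    (hG₀ : ∀ j < n, G 0 j = 0) (hG₁ : ∀ j < n, G m j = 0)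
    (hH₀ : ∀ i < m, H i 0 = 0) (hH₁ : ∀ i < m, H i n = 0) :
    ∑ i ∈ range m, ∑ j ∈ range n, F' i j = ∑ i ∈ range m, ∑ j ∈ range n, F i j := by
  -- Summed over the whole slab, `G` and `H` telescope to their values on the side walls, which
  -- vanish.
  have h1 : ∑ i ∈ range m, ∑ j ∈ range n,
      (G (i + 1) j + G i j + (H i (j + 1) + H i j) + (F' i j + F i j)) = 0 :=
    sum_eq_zero fun i hi => sum_eq_zero fun j hj => h i (mem_range.1 hi) j (mem_range.1 hj)
  have hG : ∑ i ∈ range m, ∑ j ∈ range n, (G (i + 1) j + G i j) = 0 := by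
    rw [sum_comm]
    refine sum_eq_zero fun j hj => ?_
    rw [sum_range_succ_add_self fun i => G i j, hG₀ j (mem_range.1 hj), hG₁ j (mem_range.1 hj),
      add_zero]
  have hH : ∑ i ∈ range m, ∑ j ∈ range n, (H i (j + 1) + H i j) = 0 := by
    refine sum_eq_zero fun i hi => ?_
    rw [sum_range_succ_add_self, hH₀ i (mem_range.1 hi), hH₁ i (mem_range.1 hi), add_zero]
  simp only [sum_add_distrib (f := fun _ => _ + _)] at h1
  rw [sum_add_distrib, hG, hH, zero_add, zero_add] at h1
  simp only [sum_add_distrib] at h1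
  exact CharTwo.add_eq_zero.1 h1

/-- The violated cluster terms. -/
def bulkViolations (p : PauliVec L) : Finset (Qubit L) :=
  univ.filter fun i => 0 < i.1.1 ∧ comm p (clusterVec i) ≠ 0

lemma syndrome_eq_zero_of_notMem {p : PauliVec L} {x y z : ℤ} (hx : 0 < x)
    (hq : (x, y, z) ∈ qubitSites L) (h : (⟨(x, y, z), hq⟩ : Qubit L) ∉ bulkViolations p) :
    syndrome p x y z = 0 := by
  by_contra h0
  exact h (mem_filter.2 ⟨mem_univ _, hx, by rwa [comm_clusterVec]⟩)

lemma exists_lt_notMem {B : Finset ℤ} {n : ℕ} (h : B.card < n) : ∃ k : ℕ, k < n ∧ (k : ℤ) ∉ B := by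
  by_contra! hk
  have h1 : (range n).map Nat.castEmbedding ⊆ B := fun c hc => by
    obtain ⟨k, hk', rfl⟩ := mem_map.1 hc
    exact hk k (mem_range.1 hk')
  have h2 := card_le_card h1
  rw [card_map, card_range] at h2
  omega

/-- No violated cluster term lies in the plane `z = 2 * k + 1`. -/
def IsFreeZ (p : PauliVec L) (k : ℕ) : Prop := ∀ i ∈ bulkViolations p, i.1.2.2 ≠ 2 * k + 1

/-- No violated cluster term lies in the plane `y = 2 * k`. -/
def IsFreeY (p : PauliVec L) (k : ℕ) : Prop := ∀ i ∈ bulkViolations p, i.1.2.1 ≠ 2 * k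

/-- The parity with which the `Z` type excitation string crosses the plane `z = 2 * k + 1` within
the toric code facet. -/
def crossingZ (p : PauliVec L) (k : ℕ) : ZMod 2 :=
  ∑ j ∈ range (L.y + 1), syndrome p 0 (2 * j) (2 * k + 1)

/-- The parity with which the `X` part crosses the line `y = 2 * k` of the toric code facet. -/
def crossingY (p : PauliVec L) (k : ℕ) : ZMod 2 :=
  ∑ l ∈ range L.z, syndrome p (-1) (2 * k) (2 * l + 1)

/-- Flux conservation for edges, in the box between the toric facet and a violation-free layer. -/
lemma crossingZ_eq {p : PauliVec L} (hp : IsSymVec p) (hc : (bulkViolations p).card < L.x)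
    {k k' : ℕ} (hk : k < L.z) (hk' : k' < L.z) (hf : IsFreeZ p k) (hf' : IsFreeZ p k') :
    crossingZ p k = crossingZ p k' := by
  -- Pigeonhole among the `L.x` layers `x = 2 * m + 1`, the only ones through which an edge string
  -- can move toward the sink.
  obtain ⟨m, hm, hmB⟩ := exists_lt_notMem (B := (bulkViolations p).image fun i => (i.1.1 - 1) / 2)
    (card_image_le.trans_lt hc)
  have hlayer (y z : ℤ) (hq : (2 * (m : ℤ) + 1, y, z) ∈ qubitSites L) :
      syndrome p (2 * m + 1) y z = 0 := by
    refine syndrome_eq_zero_of_notMem (by omega) hq fun h => hmB (mem_image.2 ⟨_, h, ?_⟩)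
    simp only; omega
  set N : ℕ → ZMod 2 := fun k =>
    ∑ i ∈ range (m + 1), ∑ j ∈ range (L.y + 1), syndrome p (2 * i) (2 * j) (2 * k + 1) with hN
  have hstep (k : ℕ) (hk : k + 1 < L.z) : N (k + 1) = N k := by
    refine flux_eq (G := fun i j => syndrome p (2 * i - 1) (2 * j) (2 * k + 2))
      (H := fun i j => syndrome p (2 * i) (2 * j - 1) (2 * k + 2)) (fun i hi j hj => ?_)
      (fun j hj => ?_) (fun j hj => ?_) (fun i hi => ?_) fun i hi => ?_
    · have h := nnSum_syndrome_vertex hp (x := 2 * i) (y := 2 * j) (z := 2 * k + 2)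
        (by rw [mem_vertices]; omega)
      have e₁ : 2 * ((i + 1 : ℕ) : ℤ) - 1 = 2 * i + 1 := by omega
      have e₂ : 2 * ((j + 1 : ℕ) : ℤ) - 1 = 2 * j + 1 := by omega
      have e₃ : 2 * ((k + 1 : ℕ) : ℤ) + 1 = 2 * k + 2 + 1 := by omega
      have e₄ : 2 * (k : ℤ) + 2 - 1 = 2 * k + 1 := by omega
      simp only [nnSum, e₄] at h
      simp only [e₁, e₂, e₃]
      exact h
    · apply syndrome_eq_zero <;> rw [mem_qubitSites] <;> omega
    · have h := hlayer (2 * j) (2 * k + 2) (by rw [mem_qubitSites]; omega)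
      simp only [show 2 * ((m + 1 : ℕ) : ℤ) - 1 = 2 * m + 1 by omega]
      exact h
    · apply syndrome_eq_zero <;> rw [mem_qubitSites] <;> omega
    · apply syndrome_eq_zero <;> rw [mem_qubitSites] <;> omega
  have hconst (k : ℕ) (hk : k < L.z) : N k = N 0 := by
    induction k with
    | zero => rfl
    | succ k ih => rw [hstep k hk, ih (by omega)]
  -- On a free plane all summands with `x > 0` vanish, leaving the facet row `i = 0`.
  have hfree (k : ℕ) (hk : k < L.z) (hf : IsFreeZ p k) : N k = crossingZ p k := by
    simp only [hN]
    rw [sum_range_succ', sum_eq_zero, zero_add]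
    · simp [crossingZ]
    · intro i hi
      refine sum_eq_zero fun j hj => ?_
      rw [mem_range] at hi hj
      exact syndrome_eq_zero_of_notMem (by push_cast; omega)
        (by rw [mem_qubitSites]; push_cast; omega) fun h => hf _ h rfl
  rw [← hfree k hk hf, ← hfree k' hk' hf', hconst k hk, hconst k' hk']

/-- The dual argument, for faces and volumes. The box now starts at `x = -1`, so violated plaquettes
are interior and need not be counted; the blocking layers are `x = 2 * m + 2`, the last being the
sink facet. -/
lemma crossingY_eq {p : PauliVec L} (hp : IsSymVec p) (hc : (bulkViolations p).card < L.x)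
    {k k' : ℕ} (hk : k ≤ L.y) (hk' : k' ≤ L.y) (hf : IsFreeY p k) (hf' : IsFreeY p k') :
    crossingY p k = crossingY p k' := by
  obtain ⟨m, hm, hmB⟩ := exists_lt_notMem (B := (bulkViolations p).image fun i => i.1.1 / 2 - 1)
    (card_image_le.trans_lt hc)
  have hlayer (y z : ℤ) (hq : (2 * (m : ℤ) + 2, y, z) ∈ qubitSites L) :
      syndrome p (2 * m + 2) y z = 0 := by
    refine syndrome_eq_zero_of_notMem (by omega) hq fun h => hmB (mem_image.2 ⟨_, h, ?_⟩)
    simp only; omega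
  set N : ℕ → ZMod 2 := fun k =>
    ∑ i ∈ range (m + 2), ∑ l ∈ range L.z, syndrome p (2 * i - 1) (2 * k) (2 * l + 1) with hN
  have hstep (k : ℕ) (hk : k + 1 ≤ L.y) : N (k + 1) = N k := by
    refine flux_eq (G := fun i l => syndrome p (2 * i - 2) (2 * k + 1) (2 * l + 1))
      (H := fun i l => syndrome p (2 * i - 1) (2 * k + 1) (2 * l)) (fun i hi l hl => ?_)
      (fun l hl => ?_) (fun l hl => ?_) (fun i hi => ?_) fun i hi => ?_
    · have h := nnSum_syndrome_cube hp (x := 2 * i - 1) (y := 2 * k + 1) (z := 2 * l + 1)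
        (by omega) (by omega) (by omega) (by omega) (by omega) (by omega) (by omega)
      have e₁ : 2 * ((i + 1 : ℕ) : ℤ) - 2 = 2 * i - 1 + 1 := by omega
      have e₂ : 2 * ((l + 1 : ℕ) : ℤ) = 2 * l + 1 + 1 := by omega
      have e₃ : 2 * ((k + 1 : ℕ) : ℤ) = 2 * k + 1 + 1 := by omega
      have e₄ : 2 * (i : ℤ) - 1 - 1 = 2 * i - 2 := by omega
      simp only [nnSum, e₄, add_sub_cancel_right (2 * (_ : ℤ))] at h
      rw [add_right_comm] at h
      simp only [e₁, e₂, e₃]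
      exact h
    · apply syndrome_eq_zero <;> rw [mem_qubitSites] <;> omega
    · have h := hlayer (2 * k + 1) (2 * l + 1) (by rw [mem_qubitSites]; omega)
      simp only [show 2 * ((m + 2 : ℕ) : ℤ) - 2 = 2 * m + 2 by omega]
      exact h
    · apply syndrome_eq_zero <;> rw [mem_qubitSites] <;> omega
    · apply syndrome_eq_zero <;> rw [mem_qubitSites] <;> omega
  have hconst (k : ℕ) (hk : k ≤ L.y) : N k = N 0 := by
    induction k with
    | zero => rfl
    | succ k ih => rw [hstep k hk, ih (by omega)]
  have hfree (k : ℕ) (hk : k ≤ L.y) (hf : IsFreeY p k) : N k = crossingY p k := by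
    simp only [hN]
    rw [sum_range_succ', sum_eq_zero, zero_add]
    · simp [crossingY]
    · intro i hi
      refine sum_eq_zero fun l hl => ?_
      rw [mem_range] at hi hl
      exact syndrome_eq_zero_of_notMem (by push_cast; omega)
        (by rw [mem_qubitSites]; push_cast; omega) fun h => hf _ h rfl
  rw [← hfree k hk hf, ← hfree k' hk' hf', hconst k hk, hconst k' hk']

/-! ### Local steps preserve the crossing parities -/

/-- The excitations cross every unobstructed plane an even number of times. -/
structure IsEvenVec (p : PauliVec L) : Prop where
  crossZ : ∀ k < L.z, IsFreeZ p k → crossingZ p k = 0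
  crossY : ∀ k ≤ L.y, IsFreeY p k → crossingY p k = 0

lemma isEvenVec_zero : IsEvenVec (0 : PauliVec L) := by
  have h (x y z : ℤ) : syndrome (0 : PauliVec L) x y z = 0 := by
    simp [syndrome, nnSum, cellExt_zero]
  constructor <;> intros <;> simp [crossingZ, crossingY, h]

lemma mem_bulkViolations_of_add {p q : PauliVec L} {i : Qubit L} (h : i ∈ bulkViolations (p + q))
    (h0 : syndrome q i.1.1 i.1.2.1 i.1.2.2 = 0) : i ∈ bulkViolations p := by
  rw [bulkViolations, mem_filter, comm_add_left, comm_clusterVec q i.2, h0, add_zero] at h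
  exact mem_filter.2 h

/-- Evenness is transported through a plane that is free of violations of `p` and not reached by
`q`: it is still free for `p + q`, has the same parity, and determines the parity at every other
free plane. -/
lemma IsEvenVec.add_local {p q : PauliVec L} (hp : IsEvenVec p) (hpq : IsSymVec (p + q)) {r : ℕ}
    {c : Cell} (hq : ∀ i : Qubit L, 2 * r < |i.1.2.1 - c.2.1| ∨ 2 * r < |i.1.2.2 - c.2.2| →
      q.1 i = 0 ∧ q.2 i = 0)
    (hy : (bulkViolations p).card + (2 * r + 3) ≤ L.y)
    (hz : (bulkViolations p).card + (2 * r + 3) < L.z)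
    (hx : (bulkViolations (p + q)).card < L.x) : IsEvenVec (p + q) := by
  have hext (x y z : ℤ) (h : 2 * r < |y - c.2.1| ∨ 2 * r < |z - c.2.2|) :
      cellExt q.1 x y z = 0 ∧ cellExt q.2 x y z = 0 := by
    unfold cellExt
    split_ifs with hm
    · exact hq ⟨(x, y, z), hm⟩ h
    · exact ⟨rfl, rfl⟩
  -- The planes to avoid are those with a violation and those that the syndrome of `q` can reach.
  -- The latter lie among `2 * r + 3` consecutive ones: radius `r`, plus one for neighbours and
  -- rounding. There are `L.z` planes in one direction and `L.y + 1` in the other, hence `<` in `hz`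
  -- and `≤` in `hy`.
  have hcard (f : Qubit L → ℤ) (t : ℤ) :
      ((bulkViolations p).image f ∪ Icc (t / 2 - r - 1) (t / 2 + r + 1)).card ≤
        (bulkViolations p).card + (2 * r + 3) := by
    refine (card_union_le _ _).trans (add_le_add card_image_le ?_)
    rw [Int.card_Icc]; omega
  constructor
  · intro k hk hf
    obtain ⟨n, hn, hnB⟩ := exists_lt_notMem
      ((hcard (fun i => (i.1.2.2 - 1) / 2) c.2.2).trans_lt hz)
    simp only [mem_union, not_or, mem_image, mem_Icc, not_exists, not_and] at hnB
    have hs (x y : ℤ) : syndrome q x y (2 * n + 1) = 0 := by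
      have h1 (z : ℤ) (hz : 2 * (n : ℤ) ≤ z) (hz' : z ≤ 2 * n + 2) : 2 * (r : ℤ) < |z - c.2.2| := by
        rw [lt_abs]; omega
      simp only [syndrome, nnSum, (hext _ _ _ (Or.inr (h1 (2 * n + 1) (by omega) (by omega)))).1,
        (hext _ _ _ (Or.inr (h1 (2 * n + 1) (by omega) (by omega)))).2,
        (hext _ _ _ (Or.inr (h1 (2 * n + 1 + 1) (by omega) (by omega)))).1,
        (hext _ _ _ (Or.inr (h1 (2 * n + 1 - 1) (by omega) (by omega)))).1, add_zero]
    have hfp : IsFreeZ p n := fun i hi h => hnB.1 i hi (by omega)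
    have hfpq : IsFreeZ (p + q) n := fun i hi h =>
      hfp i (mem_bulkViolations_of_add hi (by rw [h]; exact hs _ _)) h
    rw [crossingZ_eq hpq hx hk hn hf hfpq, ← hp.crossZ n hn hfp]
    simp only [crossingZ, syndrome_add, hs, add_zero]
  · intro k hk hf
    obtain ⟨n, hn, hnB⟩ := exists_lt_notMem
      ((hcard (fun i => i.1.2.1 / 2) c.2.1).trans_lt (Nat.lt_succ_of_le hy))
    simp only [mem_union, not_or, mem_image, mem_Icc, not_exists, not_and] at hnB
    have hs (x z : ℤ) : syndrome q x (2 * n) z = 0 := by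
      have h1 (y : ℤ) (hy : 2 * (n : ℤ) - 1 ≤ y) (hy' : y ≤ 2 * n + 1) :
          2 * (r : ℤ) < |y - c.2.1| := by
        rw [lt_abs]; omega
      simp only [syndrome, nnSum, (hext _ _ _ (Or.inl (h1 (2 * n) (by omega) (by omega)))).1,
        (hext _ _ _ (Or.inl (h1 (2 * n) (by omega) (by omega)))).2,
        (hext _ _ _ (Or.inl (h1 (2 * n + 1) (by omega) (by omega)))).1,
        (hext _ _ _ (Or.inl (h1 (2 * n - 1) (by omega) (by omega)))).1, add_zero]
    have hfp : IsFreeY p n := fun i hi h => hnB.1 i hi (by omega)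
    have hfpq : IsFreeY (p + q) n := fun i hi h =>
      hfp i (mem_bulkViolations_of_add hi (by rw [h]; exact hs _ _)) h
    rw [crossingY_eq hpq hx hk (by omega) hf hfpq, ← hp.crossY n (by omega) hfp]
    simp only [crossingY, syndrome_add, hs, add_zero]

/-! ### Operators that act as scalars on the ground space -/

/-- The operator acts on the ground space as a scalar. -/
def ActsScalar (p : PauliVec L) : Prop :=
  ∃ c : ℂ, ∀ ψ ∈ groundSpace (hamiltonian L), pauli p ψ = c • ψ

lemma actsScalar_zero : ActsScalar (0 : PauliVec L) := ⟨1, fun ψ _ => by simp [pauli_zero]⟩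

lemma ActsScalar.add {p q : PauliVec L} (hp : ActsScalar p) (hq : ActsScalar q) :
    ActsScalar (p + q) := by
  obtain ⟨c, hc⟩ := hp
  obtain ⟨d, hd⟩ := hq
  refine ⟨sgn (p.2 ⬝ᵥ q.1) * (d * c), fun ψ hψ => ?_⟩
  have h : pauli (p + q) = sgn (p.2 ⬝ᵥ q.1) • (pauli p * pauli q) := by
    rw [pauli_mul, smul_smul, sgn_mul_self, one_smul]
  rw [h, LinearMap.smul_apply, Module.End.mul_apply, hd ψ hψ, map_smul, hc ψ hψ, smul_smul,
    smul_smul, mul_assoc]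

lemma actsScalar_termVec (t : Term L) : ActsScalar (termVec t) :=
  ⟨1, fun ψ hψ => by rw [one_smul]; exact mem_groundSpace.1 hψ t⟩

lemma crossingZ_add (p q : PauliVec L) (k : ℕ) :
    crossingZ (p + q) k = crossingZ p k + crossingZ q k := by
  simp only [crossingZ, syndrome_add, sum_add_distrib]

/-- The vectors that act trivially, commute with all terms, and have even crossings. -/
def trivialVecs (L : Dims) : AddSubmonoid (PauliVec L) where
  carrier := {q | ActsScalar q ∧ (∀ t : Term L, comm q (termVec t) = 0) ∧
    ∀ k < L.z, crossingZ q k = 0}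
  zero_mem' := ⟨actsScalar_zero, fun t => comm_zero_left _, fun k _ =>
    by simp [crossingZ, syndrome, nnSum, cellExt_zero]⟩
  add_mem' := fun {p q} hp hq => ⟨hp.1.add hq.1,
    fun t => by rw [comm_add_left, hp.2.1, hq.2.1, add_zero],
    fun k hk => by rw [crossingZ_add, hp.2.2 k hk, hq.2.2 k hk, add_zero]⟩

lemma smul_mem_trivialVecs {q : PauliVec L} (hq : q ∈ trivialVecs L) (x : ZMod 2) :
    x • q ∈ trivialVecs L := by
  rcases zmod_two_cases x with rfl | rfl
  · rw [zero_smul]; exact zero_mem _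
  · rwa [one_smul]

lemma crossingZ_eq_zero_of_comm {q : PauliVec L} (hL : 1 ≤ L.x)
    (hq : ∀ i : Qubit L, comm q (clusterVec i) = 0) {k : ℕ} (hk : k < L.z) :
    crossingZ q k = 0 := by
  refine sum_eq_zero fun j hj => ?_
  rw [mem_range] at hj
  rw [← comm_clusterVec q (by rw [mem_qubitSites]; omega), hq]

lemma clusterVec_mem_trivialVecs (hL : 1 ≤ L.x) (i : Qubit L) (hi : 0 < i.1.1) :
    clusterVec i ∈ trivialVecs L :=
  ⟨actsScalar_termVec (.inl ⟨i, hi⟩), comm_clusterVec_termVec i hi, fun _ hk =>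
    crossingZ_eq_zero_of_comm hL (comm_clusterVec_clusterVec i) hk⟩

lemma starVec_mem_trivialVecs (hL : 1 ≤ L.x) {y z : ℤ} (hv : (0, y, z) ∈ vertices L) :
    starVec L (0, y, z) ∈ trivialVecs L :=
  ⟨actsScalar_termVec (.inr (.inl ⟨(0, y, z), hv, rfl⟩)), comm_starVec_termVec hv, fun _ hk =>
    crossingZ_eq_zero_of_comm hL (fun i => by rw [comm_symm, comm_clusterVec_starVec i hv]) hk⟩

/-- A facet edge meets two candidate faces (or vertices), either of which may be missing at the
boundary. -/
lemma sum_ite_pair {V : Finset Cell} (f : Cell → ZMod 2) (P : Cell → Prop) [DecidablePred P]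
    {c d : Cell} (hcd : c ≠ d) (h : ∀ v ∈ V, (P v ↔ v = c ∨ v = d)) :
    ∑ v ∈ V, (if P v then f v else 0) =
      (if c ∈ V then f c else 0) + if d ∈ V then f d else 0 := by
  have h1 : ∀ v ∈ V, (if P v then f v else 0) =
      (if v = c then f v else 0) + if v = d then f v else 0 := fun v hv => by
    rw [if_congr (h v hv) rfl rfl]
    by_cases h1 : v = c
    · subst h1; simp [hcd]
    · simp [h1]
  rw [sum_congr rfl h1, sum_add_distrib, sum_ite_eq', sum_ite_eq']

/-- A `Z` type operator that commutes with the Hamiltonian and has even crossings is a product of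
plaquette terms. -/
lemma actsScalar_of_Z_type (hL : 1 ≤ L.x) {p : PauliVec L} (hp : p.1 = 0)
    (hcomm : ∀ t : Term L, comm p (termVec t) = 0)
    (hcross : ∀ k < L.z, crossingZ p k = 0) : ActsScalar p := by
  set B : ℤ → ℤ → ZMod 2 := fun y z => cellExt p.2 0 y z with hB
  have hBout (y z : ℤ) (h : ((0 : ℤ), y, z) ∉ qubitSites L) : B y z = 0 := cellExt_eq_zero _ h
  have hsyn (x y z : ℤ) : syndrome p x y z = cellExt p.2 x y z := by
    simp [syndrome, nnSum, hp, cellExt_zero]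
  have hstar (y z : ℤ) (hv : (0, y, z) ∈ vertices L) :
      B (y + 1) z + B (y - 1) z + B y (z + 1) + B y (z - 1) = 0 := by
    have h := hcomm (.inr (.inl ⟨(0, y, z), hv, rfl⟩))
    simpa only [termVec, comm_starVec _ hv, hp, cellExt_zero, add_zero] using h
  have hcr (z : ℤ) (hz : z % 2 = 1) (h1 : 1 ≤ z) (h2 : z ≤ 2 * L.z - 1) :
      ∑ j ∈ range (L.y + 1), B (2 * j) z = 0 := by
    have h := hcross ((z - 1) / 2).toNat (by omega)
    simp only [crossingZ, hsyn] at h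
    rwa [show 2 * ((((z - 1) / 2).toNat : ℕ) : ℤ) + 1 = z by omega] at h
  -- Discrete integration in the `y` direction: the coefficient of a plaquette is the sum of `B`
  -- over the edges preceding it in its row, so consecutive plaquettes differ by the edge between
  -- them.
  set χ : ℕ → ℤ → ZMod 2 := fun n z => ∑ j ∈ range n, B (2 * j) z with hχ
  set ψ : Cell → ZMod 2 := fun f => χ ((f.2.1 + 1) / 2).toNat f.2.2 with hψ
  set F₀ := (faces L).filter fun f => f.1 = 0 with hF₀
  have hmem (x y z : ℤ) : (x, y, z) ∈ F₀ ↔ (((0 ≤ y ∧ y ≤ 2 * L.y) ∧ 1 ≤ z ∧ z ≤ 2 * L.z - 1) ∧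
      y % 2 + z % 2 = 2) ∧ x = 0 := by
    rw [hF₀, mem_filter, mem_faces]; constructor <;> intro h <;> omega
  suffices h : p = ∑ f ∈ F₀, ψ f • plaquetteVec L f by
    have hs : ∑ f ∈ F₀, ψ f • plaquetteVec L f ∈ {q | ActsScalar q} := by
      refine sum_induction _ ActsScalar (fun _ _ => ActsScalar.add) actsScalar_zero ?_
      rintro f hf
      rcases zmod_two_cases (ψ f) with h | h
      · rw [h, zero_smul]; exact actsScalar_zero
      · rw [h, one_smul]
        exact actsScalar_termVec (.inr (.inr ⟨f, mem_filter.1 hf⟩))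
    rw [h]; exact hs
  refine Prod.ext ?_ (funext fun e => ?_)
  · rw [hp, Prod.fst_sum]
    exact (sum_eq_zero fun f _ => by simp [plaquetteVec]).symm
  rw [Prod.snd_sum, Finset.sum_apply]
  obtain ⟨⟨x, y, z⟩, hq⟩ := e
  have hq' := mem_qubitSites.1 hq
  have hterm (f : Cell) : (ψ f • plaquetteVec L f).2 ⟨(x, y, z), hq⟩ =
      if cellDim (x, y, z) = 1 ∧ Inside (x, y, z) f then ψ f else 0 := by
    simp only [plaquetteVec, Prod.smul_snd, Pi.smul_apply, ind, mem_filter, mem_univ, true_and,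
      smul_eq_mul, mul_ite, mul_one, mul_zero]
  simp only [hterm]
  by_cases hx : 0 < x
  · have h0 : p.2 ⟨(x, y, z), hq⟩ = 0 := by
      have h := hcomm (.inl ⟨⟨(x, y, z), hq⟩, hx⟩)
      rwa [termVec, comm_clusterVec, hsyn, cellExt_of_mem _ hq] at h
    rw [h0]
    refine (sum_eq_zero ?_).symm
    rintro ⟨a, b, c⟩ hf
    rw [hmem] at hf
    refine if_neg fun h => ?_
    have := (inside_iff.1 h.2).1
    omega
  obtain rfl : x = 0 := by omega
  have hval : p.2 ⟨(0, y, z), hq⟩ = B y z := (cellExt_of_mem _ hq).symm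
  rw [hval]
  by_cases hy : y % 2 = 0
  · obtain ⟨n, rfl⟩ : ∃ n : ℕ, y = 2 * n := ⟨(y / 2).toNat, by omega⟩
    rw [sum_ite_pair (c := (0, 2 * n + 1, z)) (d := (0, 2 * n - 1, z)) _ _
      (by rw [Ne, Prod.mk.injEq, Prod.mk.injEq]; omega)]
    · have e₁ : (if ((0 : ℤ), 2 * (n : ℤ) + 1, z) ∈ F₀ then ψ (0, 2 * n + 1, z) else 0) =
          χ (n + 1) z := by
        split_ifs with h
        · simp only [hψ]
          rw [show ((2 * (n : ℤ) + 1 + 1) / 2).toNat = n + 1 by omega]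
        · rw [hmem] at h
          obtain rfl : n = L.y := by omega
          -- The edge at `y = 2 * L.y` has no plaquette beyond it; the even crossing makes the full
          -- row sum zero, as required.
          exact (hcr z (by omega) (by omega) (by omega)).symm
      have e₂ : (if ((0 : ℤ), 2 * (n : ℤ) - 1, z) ∈ F₀ then ψ (0, 2 * n - 1, z) else 0) =
          χ n z := by
        split_ifs with h
        · simp only [hψ]
          rw [show ((2 * (n : ℤ) - 1 + 1) / 2).toNat = n by omega]
        · rw [hmem] at h
          obtain rfl : n = 0 := by omega
          simp [hχ]
      rw [e₁, e₂]
      simp only [hχ]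
      rw [sum_range_succ, add_right_comm, CharTwo.add_self_eq_zero, zero_add]
    · rintro ⟨a, b, c⟩ hf
      rw [hmem] at hf
      simp only [inside_iff, cellDim, Prod.mk.injEq]
      constructor
      · rintro ⟨h1, h2, h3, h4⟩; omega
      · intro h; omega
  · obtain ⟨n, rfl⟩ : ∃ n : ℕ, y = 2 * n - 1 := ⟨((y + 1) / 2).toNat, by omega⟩
    rw [sum_ite_pair (c := (0, 2 * n - 1, z + 1)) (d := (0, 2 * n - 1, z - 1)) _ _
      (by rw [Ne, Prod.mk.injEq, Prod.mk.injEq]; omega)]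
    · rw [if_pos (by rw [hmem]; omega), if_pos (by rw [hmem]; omega)]
      simp only [hψ]
      rw [show ((2 * (n : ℤ) - 1 + 1) / 2).toNat = n by omega]
      simp only [hχ]
      rw [← sum_add_distrib]
      -- The star conditions turn the difference of two adjacent rows into a telescoping sum of the
      -- edges joining them.
      have h1 : ∀ j ∈ range n, B (2 * j) (z + 1) + B (2 * j) (z - 1) =
          (fun j : ℕ => B (2 * j - 1) z) (j + 1) + (fun j : ℕ => B (2 * j - 1) z) j := by
        intro j hj
        rw [mem_range] at hj
        have h := hstar (2 * j) z (by rw [mem_vertices]; omega)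
        simp only
        rw [show 2 * ((j + 1 : ℕ) : ℤ) - 1 = 2 * j + 1 by omega]
        rw [add_assoc] at h
        exact (CharTwo.add_eq_zero.1 h).symm
      rw [sum_congr rfl h1, sum_range_succ_add_self fun j : ℕ => B (2 * j - 1) z]
      rw [hBout (2 * ((0 : ℕ) : ℤ) - 1) z (by rw [mem_qubitSites]; omega), add_zero]
    · rintro ⟨a, b, c⟩ hf
      rw [hmem] at hf
      simp only [inside_iff, cellDim, Prod.mk.injEq]
      constructor
      · rintro ⟨h1, h2, h3, h4⟩; omega
      · intro h; omega

lemma PauliVec.add_self (q : PauliVec L) : q + q = 0 := by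
  ext i <;> exact CharTwo.add_self_eq_zero _

lemma ActsScalar.of_add {p q : PauliVec L} (h : ActsScalar (p + q)) (hq : ActsScalar q) :
    ActsScalar p := by
  have := h.add hq
  rwa [add_assoc, PauliVec.add_self, add_zero] at this

/-- The `X` part on the toric code facet of an operator that commutes with the Hamiltonian and has
even crossings is removed by star terms. -/
lemma actsScalar_of_facet_X (hL : 1 ≤ L.x) {p : PauliVec L}
    (hp : ∀ i : Qubit L, 0 < i.1.1 → p.1 i = 0)
    (hcomm : ∀ t : Term L, comm p (termVec t) = 0)
    (hcross : ∀ k < L.z, crossingZ p k = 0)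
    (hcrossY : ∀ k ≤ L.y, ∑ l ∈ range L.z, cellExt p.1 0 (2 * k) (2 * l + 1) = 0) :
    ActsScalar p := by
  set A : ℤ → ℤ → ZMod 2 := fun y z => cellExt p.1 0 y z with hA
  have hAout (y z : ℤ) (h : ((0 : ℤ), y, z) ∉ qubitSites L) : A y z = 0 := cellExt_eq_zero _ h
  have hplaq (y z : ℤ) (hf : (0, y, z) ∈ faces L) :
      A (y + 1) z + A (y - 1) z + (A y (z + 1) + A y (z - 1)) = 0 := by
    have h := hcomm (.inr (.inr ⟨(0, y, z), hf, rfl⟩))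
    rw [termVec, comm_plaquetteVec _ hf, syndrome, nnSum] at h
    rw [mem_faces] at hf
    rwa [cellExt_eq_zero p.2, cellExt_eq_zero p.1 (x := 0 + 1), cellExt_eq_zero p.1 (x := 0 - 1),
      zero_add, zero_add, zero_add] at h
    all_goals rw [mem_qubitSites]; omega
  have hcr (y : ℤ) (hy : y % 2 = 0) (h1 : 0 ≤ y) (h2 : y ≤ 2 * L.y) :
      ∑ l ∈ range L.z, A y (2 * l + 1) = 0 := by
    have h := hcrossY (y / 2).toNat (by omega)
    rwa [show 2 * (((y / 2).toNat : ℕ) : ℤ) = y by omega] at h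
  -- The same integration on the dual lattice, in the `z` direction: stars replace plaquettes, and
  -- `hplaq` replaces the star conditions.
  set χ : ℤ → ℕ → ZMod 2 := fun y n => ∑ l ∈ range n, A y (2 * l + 1) with hχ
  set φ : Cell → ZMod 2 := fun v => χ v.2.1 (v.2.2 / 2).toNat with hφ
  set V₀ := (vertices L).filter fun v => v.1 = 0 with hV₀
  have hmem (x y z : ℤ) : (x, y, z) ∈ V₀ ↔ (((0 ≤ y ∧ y ≤ 2 * L.y) ∧ 1 ≤ z ∧ z ≤ 2 * L.z - 1) ∧
      y % 2 + z % 2 = 0) ∧ x = 0 := by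
    rw [hV₀, mem_filter, mem_vertices]; constructor <;> intro h <;> omega
  set s : PauliVec L := ∑ v ∈ V₀, φ v • starVec L v with hs
  have hsmem : s ∈ trivialVecs L := by
    refine sum_mem fun v hv => smul_mem_trivialVecs ?_ _
    obtain ⟨x, y, z⟩ := v
    obtain ⟨hv, rfl : x = 0⟩ := mem_filter.1 hv
    exact starVec_mem_trivialVecs hL hv
  refine ActsScalar.of_add (q := s) ?_ hsmem.1
  refine actsScalar_of_Z_type hL ?_ (fun t => by rw [comm_add_left, hcomm, hsmem.2.1, add_zero])
    fun k hk => by rw [crossingZ_add, hcross k hk, hsmem.2.2 k hk, add_zero]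
  suffices h : p.1 = s.1 by
    rw [Prod.fst_add, h, ← Prod.fst_add, PauliVec.add_self, Prod.fst_zero]
  funext e
  rw [hs, Prod.fst_sum, Finset.sum_apply]
  obtain ⟨⟨x, y, z⟩, hq⟩ := e
  have hq' := mem_qubitSites.1 hq
  have hterm (v : Cell) : (φ v • starVec L v).1 ⟨(x, y, z), hq⟩ =
      if cellDim (x, y, z) = 1 ∧ x = 0 ∧ Inside v (x, y, z) then φ v else 0 := by
    simp only [starVec, toricStar, Prod.smul_fst, Pi.smul_apply, ind, mem_filter, mem_univ,
      true_and, smul_eq_mul, mul_ite, mul_one, mul_zero]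
  simp only [hterm]
  by_cases hx : 0 < x
  · rw [hp _ hx]
    exact (sum_eq_zero fun v _ => if_neg fun h => by omega).symm
  obtain rfl : x = 0 := by omega
  have hval : p.1 ⟨(0, y, z), hq⟩ = A y z := (cellExt_of_mem _ hq).symm
  rw [hval]
  by_cases hy : y % 2 = 0
  · obtain ⟨n, rfl⟩ : ∃ n : ℕ, z = 2 * n + 1 := ⟨((z - 1) / 2).toNat, by omega⟩
    rw [sum_ite_pair (c := (0, y, 2 * n + 2)) (d := (0, y, 2 * n)) _ _
      (by rw [Ne, Prod.mk.injEq, Prod.mk.injEq]; omega)]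
    · have e₁ : (if ((0 : ℤ), y, 2 * (n : ℤ) + 2) ∈ V₀ then φ (0, y, 2 * n + 2) else 0) =
          χ y (n + 1) := by
        split_ifs with h
        · simp only [hφ]
          rw [show ((2 * (n : ℤ) + 2) / 2).toNat = n + 1 by omega]
        · rw [hmem] at h
          rw [show n + 1 = L.z by omega]
          exact (hcr y (by omega) (by omega) (by omega)).symm
      have e₂ : (if ((0 : ℤ), y, 2 * (n : ℤ)) ∈ V₀ then φ (0, y, 2 * n) else 0) =
          χ y n := by
        split_ifs with h
        · simp only [hφ]
          rw [show ((2 * (n : ℤ)) / 2).toNat = n by omega]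
        · rw [hmem] at h
          obtain rfl : n = 0 := by omega
          simp [hχ]
      rw [e₁, e₂]
      simp only [hχ]
      rw [sum_range_succ, add_right_comm, CharTwo.add_self_eq_zero, zero_add]
    · rintro ⟨a, b, c⟩ hf
      rw [hmem] at hf
      simp only [inside_iff, cellDim, Prod.mk.injEq, true_and]
      constructor
      · rintro ⟨h1, h2, h3, h4⟩; omega
      · intro h; omega
  · obtain ⟨n, rfl⟩ : ∃ n : ℕ, z = 2 * n := ⟨(z / 2).toNat, by omega⟩
    rw [sum_ite_pair (c := (0, y + 1, 2 * n)) (d := (0, y - 1, 2 * n)) _ _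
      (by rw [Ne, Prod.mk.injEq, Prod.mk.injEq]; omega)]
    · rw [if_pos (by rw [hmem]; omega), if_pos (by rw [hmem]; omega)]
      simp only [hφ]
      rw [show (2 * (n : ℤ) / 2).toNat = n by omega]
      simp only [hχ]
      rw [← sum_add_distrib]
      have h1 : ∀ l ∈ range n, A (y + 1) (2 * l + 1) + A (y - 1) (2 * l + 1) =
          (fun l : ℕ => A y (2 * l)) (l + 1) + (fun l : ℕ => A y (2 * l)) l := by
        intro l hl
        rw [mem_range] at hl
        have h := hplaq y (2 * l + 1) (by rw [mem_faces]; omega)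
        simp only
        rw [show 2 * ((l + 1 : ℕ) : ℤ) = 2 * l + 1 + 1 by omega]
        rw [add_sub_cancel_right] at h
        exact CharTwo.add_eq_zero.1 h
      rw [sum_congr rfl h1, sum_range_succ_add_self fun l : ℕ => A y (2 * l)]
      rw [hAout y (2 * ((0 : ℕ) : ℤ)) (by rw [mem_qubitSites]; omega), add_zero]
    · rintro ⟨a, b, c⟩ hf
      rw [hmem] at hf
      simp only [inside_iff, cellDim, Prod.mk.injEq, true_and]
      constructor
      · rintro ⟨h1, h2, h3, h4⟩; omega
      · intro h; omega

/-- An operator that commutes with the Hamiltonian and has even crossings acts as a scalar on the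
ground space. -/
lemma actsScalar_of_even (hL : 1 ≤ L.x) {p : PauliVec L}
    (hcomm : ∀ t : Term L, comm p (termVec t) = 0) (heven : IsEvenVec p) : ActsScalar p := by
  have hviol : bulkViolations p = ∅ :=
    filter_eq_empty_iff.2 fun i _ h => h.2 (hcomm (.inl ⟨i, h.1⟩))
  have hZ : ∀ k < L.z, crossingZ p k = 0 := fun k hk =>
    heven.crossZ k hk fun i hi => by simp [hviol] at hi
  have hY : ∀ k ≤ L.y, crossingY p k = 0 := fun k hk =>
    heven.crossY k hk fun i hi => by simp [hviol] at hi
  -- Each cluster term has a single `X`, so this product cancels the `X` part of `p` off the facet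
  -- and leaves the part on the facet unchanged.
  set s : PauliVec L := ∑ i : {i : Qubit L // 0 < i.1.1}, p.1 i.1 • clusterVec i.1 with hs
  have hsmem : s ∈ trivialVecs L := sum_mem fun i _ =>
    smul_mem_trivialVecs (clusterVec_mem_trivialVecs hL i.1 i.2) _
  have hs1 (i : Qubit L) : s.1 i = if 0 < i.1.1 then p.1 i else 0 := by
    rw [hs, Prod.fst_sum, Finset.sum_apply]
    simp only [clusterVec, Prod.smul_fst, Pi.smul_apply, ind, mem_singleton, smul_eq_mul, mul_ite,
      mul_one, mul_zero]
    split_ifs with h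
    · rw [sum_eq_single ⟨i, h⟩, if_pos rfl]
      · exact fun j _ hj => if_neg fun h => hj (Subtype.ext h.symm)
      · exact fun h => absurd (mem_univ _) h
    · exact sum_eq_zero fun j _ => if_neg fun hj => h (by rw [hj]; exact j.2)
  refine ActsScalar.of_add (q := s) ?_ hsmem.1
  refine actsScalar_of_facet_X hL (fun i hi => ?_)
    (fun t => by rw [comm_add_left, hcomm, hsmem.2.1, add_zero])
    (fun k hk => by rw [crossingZ_add, hZ k hk, hsmem.2.2 k hk, add_zero]) fun k hk => ?_
  · rw [Prod.fst_add, Pi.add_apply, hs1, if_pos hi]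
    exact CharTwo.add_self_eq_zero _
  · rw [← hY k hk]
    refine sum_congr rfl fun l hl => ?_
    have h1 : cellExt s.1 0 (2 * k) (2 * l + 1) = 0 := by
      unfold cellExt
      split_ifs with h
      · rw [hs1]; exact if_neg (lt_irrefl _)
      · rfl
    rw [Prod.fst_add, cellExt_add, h1, add_zero, syndrome, nnSum]
    rw [cellExt_eq_zero p.2, cellExt_eq_zero p.1 (x := -1 - 1),
      cellExt_eq_zero p.1 (y := 2 * k + 1), cellExt_eq_zero p.1 (y := 2 * k - 1),
      cellExt_eq_zero p.1 (x := -1) (z := 2 * l + 1 + 1),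
      cellExt_eq_zero p.1 (x := -1) (z := 2 * l + 1 - 1)]
    · simp
    all_goals rw [mem_qubitSites]; omega

/-! ### The energy barrier -/

lemma isSymVec_of_commute {c : ℂ} (hc : c ≠ 0) {p : PauliVec L}
    (h : ∀ g ∈ symGroup L, Commute (c • pauli p) g) : IsSymVec p where
  vertex _ _ _ hv := nnSum_eq_zero_of_commute_symV hc hv
    (h _ (Submonoid.subset_closure (Or.inl ⟨_, hv, rfl⟩)))
  cube _ _ _ hq := nnSum_eq_zero_of_commute_symQ hc hq
    (h _ (Submonoid.subset_closure (Or.inr ⟨_, hq, rfl⟩)))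

lemma card_bulkViolations_le (p : PauliVec L) :
    (bulkViolations p).card ≤ minusCount fun t : Term L => comm p (termVec t) := by
  have h1 : bulkViolations p = ((univ : Finset {i : Qubit L // 0 < i.1.1}).filter
      fun i => comm p (clusterVec i.1) ≠ 0).map (Function.Embedding.subtype _) := by
    ext i
    simp only [bulkViolations, mem_filter, mem_univ, true_and, mem_map,
      Function.Embedding.subtype_apply, Subtype.exists, exists_and_left, exists_prop,
      exists_eq_right_right]
    tauto
  rw [h1, card_map, ← card_map Function.Embedding.inl]
  refine card_le_card fun t ht => ?_
  obtain ⟨i, hi, rfl⟩ := mem_map.1 ht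
  exact mem_filter.2 ⟨mem_univ _, (mem_filter.1 hi).2⟩

/-- A term anticommuting with `p` would have eigenvalue `-1` on the image of a ground state. -/
lemma comm_termVec_eq_zero_of_preserves {c : ℂ} (hc : c ≠ 0) {p : PauliVec L}
    (h : ∀ ψ ∈ groundSpace (hamiltonian L), (c • pauli p) ψ ∈ groundSpace (hamiltonian L))
    (t : Term L) : comm p (termVec t) = 0 := by
  obtain ⟨Ω, h0, hΩ⟩ := exists_ground_state L
  have h1 := h Ω (mem_groundSpace.2 hΩ)
  rw [LinearMap.smul_apply, Submodule.smul_mem_iff _ hc] at h1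
  have h2 := mem_groundSpace.1 h1 t
  rw [term_apply_pauli (σ := 0) p (by rw [sgn_zero, one_smul, hΩ]), zero_add] at h2
  have h3 : pauli p Ω ≠ 0 := fun h => h0 (pauli_injective p (h.trans (map_zero _).symm))
  exact sgn_eq_one_iff.1 (smul_left_injective ℂ h3 (h2.trans (one_smul ℂ _).symm))

lemma IsLogical.not_actsScalar {c : ℂ} {p : PauliVec L}
    (h : IsLogical (hamiltonian L) (c • pauli p)) : ¬ ActsScalar p := by
  rintro ⟨d, hd⟩
  exact h.2.2 ⟨c * d, fun ψ hψ => by rw [LinearMap.smul_apply, hd ψ hψ, smul_smul]⟩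

/-- One step of a symmetric local decomposition keeps the crossings even. -/
lemma exists_even_step {r : ℕ} {c : ℂ} {q : PauliVec L} {P Q : Op L} (hc : c ≠ 0)
    (hq : IsEvenVec q) (hP : IsLocalPauli r P) (hQ : Q = P * c • pauli q)
    (hsym : ∀ g ∈ symGroup L, Commute Q g)
    (hy : (bulkViolations q).card + (2 * r + 3) ≤ L.y)
    (hz : (bulkViolations q).card + (2 * r + 3) < L.z)
    (hx : ∀ (d : ℂ) (q' : PauliVec L), d ≠ 0 → Q = d • pauli q' →
      (bulkViolations q').card < L.x) :
    ∃ (d : ℂ) (q' : PauliVec L), d ≠ 0 ∧ Q = d • pauli q' ∧ IsEvenVec q' := by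
  obtain ⟨A, hPA, hA⟩ := hP
  obtain ⟨b, s, hb, rfl, hs⟩ := hPA.exists_vec
  have hQ' : Q = (b * c * sgn (s.2 ⬝ᵥ q.1)) • pauli (q + s) := by
    rw [hQ, smul_mul_smul_comm, pauli_mul, smul_smul, add_comm]
  have hd : b * c * sgn (s.2 ⬝ᵥ q.1) ≠ 0 := mul_ne_zero (mul_ne_zero hb hc) (sgn_ne_zero _)
  have hsymv : IsSymVec (q + s) := isSymVec_of_commute hd (hQ' ▸ hsym)
  refine ⟨_, _, hd, hQ', ?_⟩
  rcases A.eq_empty_or_nonempty with rfl | ⟨i₀, hi₀⟩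
  · exact hq.add_local (c := 0) hsymv (fun i _ => hs i (notMem_empty i)) hy hz (hx _ _ hd hQ')
  · refine hq.add_local (c := i₀.1) hsymv (fun i hi => hs i fun hiA => ?_) hy hz (hx _ _ hd hQ')
    have h := hA i hiA i₀ hi₀
    rcases hi with hi | hi
    · exact absurd h.2.1 (not_le.2 hi)
    · exact absurd h.2.2 (not_le.2 hi)

/-- Along a symmetric local decomposition of a logical operator, at some point the number of
violated cluster terms is comparable to the linear size. -/
lemma exists_many_violations {r : ℕ} (hL : 1 ≤ L.x) {l : Op L}
    (hl : IsLogical (hamiltonian L) l) {N : ℕ} {p : Fin (N + 1) → Op L}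
    (hp : IsSymLocalDecomp (symGroup L) r l p) :
    ∃ (k : Fin (N + 1)) (c : ℂ) (q : PauliVec L), c ≠ 0 ∧ p k = c • pauli q ∧
      min L.x (min L.y L.z) ≤ (bulkViolations q).card + (2 * r + 3) := by
  by_contra! hlow
  have key : ∀ k : Fin (N + 1), ∃ (c : ℂ) (q : PauliVec L), c ≠ 0 ∧ p k = c • pauli q ∧
      IsEvenVec q := by
    intro k
    induction k using Fin.induction with
    | zero =>
      exact ⟨1, 0, one_ne_zero, by rw [hp.first, pauli_zero, one_smul], isEvenVec_zero⟩
    | succ k ih =>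
      obtain ⟨c, q, hc, hpk, hq⟩ := ih
      obtain ⟨P, hP, hstep⟩ := hp.step k
      have h1 := hlow _ c q hc hpk
      rw [hpk] at hstep
      refine exists_even_step hc hq hP hstep (hp.symmetric _) (by omega) (by omega)
        fun d q' hd hq' => ?_
      have h2 := hlow _ d q' hd hq'
      omega
  obtain ⟨c, q, hc, hpk, hq⟩ := key (Fin.last N)
  rw [hp.last] at hpk
  subst hpk
  exact hl.not_actsScalar
    (actsScalar_of_even hL (comm_termVec_eq_zero_of_preserves hc hl.2.1) hq)

lemma le_symEnergyBarrier {r : ℕ} (hL : 1 ≤ L.x) {B : ℝ}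
    (hB : B ≤ 2 * ((min L.x (min L.y L.z) : ℕ) - (2 * r + 3))) :
    (B : EReal) ≤ symEnergyBarrier (hamiltonian L) (symGroup L) r := by
  refine le_iInf₂ fun l hl => le_iInf₂ fun N p => le_iInf fun hp => ?_
  obtain ⟨k, c, q, hc, hpk, hq⟩ := exists_many_violations hL hl hp
  have hE := hasEnergy_pauli hc q
  rw [← hpk] at hE
  refine le_iSup_of_le k (le_iSup₂_of_le _ hE ?_)
  rw [EReal.coe_le_coe_iff, groundEnergy_eq]
  have h1 : ((min L.x (min L.y L.z) : ℕ) : ℝ) ≤ (bulkViolations q).card + (2 * r + 3) := by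
    exact_mod_cast hq
  have h2 : ((bulkViolations q).card : ℝ) ≤
      (minusCount fun t : Term L => comm q (termVec t) : ℕ) := by
    exact_mod_cast card_bulkViolations_le q
  linarith

/-! ### The lattice width -/

lemma exists_walk_of_adj (Γ : SimpleGraph Cell) (s : ℕ → Cell) (n : ℕ)
    (h : ∀ k < n, Γ.Adj (s k) (s (k + 1))) : ∃ w : Γ.Walk (s 0) (s n), w.length = n := by
  induction n with
  | zero => exact ⟨.nil, rfl⟩
  | succ n ih =>
    obtain ⟨w, hw⟩ := ih fun k hk => h k (by omega)
    exact ⟨w.concat (h n (by omega)), by rw [SimpleGraph.Walk.length_concat, hw]⟩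

lemma walkDist_le {Γ : SimpleGraph Cell} {A B : Set Cell} (s : ℕ → Cell) (n : ℕ)
    (h : ∀ k < n, Γ.Adj (s k) (s (k + 1))) (hA : s 0 ∈ A) (hB : s n ∈ B) :
    walkDist Γ A B ≤ n := by
  obtain ⟨w, hw⟩ := exists_walk_of_adj Γ s n h
  exact Nat.sInf_le ⟨_, hA, _, hB, w, hw⟩

lemma dZ_le (hx : 1 ≤ L.x) : dZ L ≤ L.z := by
  refine walkDist_le (fun k => (0, 0, 2 * k)) _ (fun k hk => ?_) ?_ ?_
  · rw [latticeGraph, SimpleGraph.fromRel_adj]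
    refine ⟨by simp, Or.inl ⟨by simp only [cellDim]; omega, by simp only [cellDim]; omega,
      (0, 0, 2 * k + 1), by rw [mem_edges]; omega, ?_, ?_⟩⟩ <;> rw [inside_iff] <;> omega
  · simp [cellDim]
  · exact ⟨by simp only [cellDim]; omega, rfl, rfl⟩

lemma dX_le (hx : 1 ≤ L.x) (hz : 1 ≤ L.z) : dX L ≤ L.y + 1 := by
  refine walkDist_le (fun k => (0, 2 * k - 1, 1)) _ (fun k hk => ?_) ?_ ?_
  · rw [toricDualGraph, SimpleGraph.fromRel_adj]
    refine ⟨by simp, Or.inl ⟨⟨by simp only [cellDim]; omega, rfl⟩,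
      ⟨by simp only [cellDim]; omega, rfl⟩,
      (0, 2 * k, 1), by rw [mem_edges]; omega, rfl, ?_, ?_⟩⟩ <;> rw [inside_iff] <;> omega
  · simp [cellDim]
  · exact ⟨by simp only [cellDim]; omega, rfl, by push_cast; ring⟩

lemma dCond_le (hz : 2 ≤ L.z) : dCond L ≤ L.x := by
  refine walkDist_le (fun k => (2 * k, 0, 2)) _ (fun k hk => ?_) ?_ ?_
  · rw [latticeGraph, SimpleGraph.fromRel_adj]
    refine ⟨by simp, Or.inl ⟨by simp only [cellDim]; omega, by simp only [cellDim]; omega,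
      (2 * k + 1, 0, 2), by rw [mem_edges]; omega, ?_, ?_⟩⟩ <;> rw [inside_iff] <;> omega
  · simp [cellDim]
  · exact ⟨by simp only [cellDim]; omega, rfl⟩

/-- Only an upper bound on the width is needed, so straight paths suffice. The `+ 1` accounts for
the dual path, which crosses `L.y + 1` edges. -/
lemma latticeWidth_le (hx : 1 ≤ L.x) (hz : 2 ≤ L.z) :
    latticeWidth L ≤ min L.x (min L.y L.z) + 1 := by
  have h1 := dZ_le (L := L) hx
  have h2 := dX_le (L := L) hx (by omega)
  have h3 := dCond_le (L := L) hz
  unfold latticeWidth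
  omega

end RBH

end

theorem mainTheorem1 (r : ℕ) :
    ∃ r' : ℝ,
      (∀ L : RBH.Dims, 1 ≤ L.x → 1 ≤ L.y → 2 ≤ L.z →
        RBH.energyGap (RBH.hamiltonian L) = 2 ∧
        (((RBH.latticeWidth L : ℝ) * (RBH.energyGap (RBH.hamiltonian L) / 2) - r' : ℝ) : EReal) ≤
          RBH.symEnergyBarrier (RBH.hamiltonian L) (RBH.symGroup L) r) ∧
      (∀ n : ℕ, 2 ≤ n →
        (((n : ℝ) * (RBH.energyGap (RBH.hamiltonian ⟨n, n, n⟩) / 2) - r' : ℝ) : EReal) ≤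
          RBH.symEnergyBarrier (RBH.hamiltonian ⟨n, n, n⟩) (RBH.symGroup ⟨n, n, n⟩) r) := by
  -- With `m` the least side, the proven bound is `2 * (m - (2 * r + 3))`, while the width is at
  -- most `m + 1`; since `m ≥ 0`, the former is at least `(m + 1) - (4 * r + 7)`.
  refine ⟨4 * r + 7, fun L hx _ hz => ⟨RBH.energyGap_eq hx hz, ?_⟩, fun n hn => ?_⟩
  · apply RBH.le_symEnergyBarrier hx
    rw [RBH.energyGap_eq hx hz]
    have h1 : (RBH.latticeWidth L : ℝ) ≤ (min L.x (min L.y L.z) : ℕ) + 1 := by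
      exact_mod_cast RBH.latticeWidth_le hx hz
    have h2 : (0 : ℝ) ≤ (min L.x (min L.y L.z) : ℕ) := Nat.cast_nonneg _
    linarith
  · have hx : 1 ≤ (⟨n, n, n⟩ : RBH.Dims).x := by simp only; omega
    apply RBH.le_symEnergyBarrier hx
    rw [RBH.energyGap_eq hx hn]
    simp only [min_self]
    have h2 : (0 : ℝ) ≤ n := Nat.cast_nonneg _
    linarith
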